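/- Let $\mathcal H_A,\mathcal H_B$ be finite-dimensional complex Hilbert spaces and let $\varrho$ be a state (positive semidefinite operator of trace $1$) on $\mathcal H_A\otimes\mathcal H_B$. A state on a tensor product of two such spaces is called separable if it is a finite convex combination $\sum_i p_i\,\sigma_i\otimes\tau_i$ of products of states, and entangled otherwise. The power $\varrho^{\otimes n}$ is regarded as a bipartite state on $\mathcal H_A^{\otimes n}\otimes\mathcal H_B^{\otimes n}$, Alice holding $\mathcal H_A^{\otimes n}$ and Bob holding $\mathcal H_B^{\otimes n}$. An LQCC operation $\Lambda$ (local quantum operations and classical communication) is given by a protocol of finitely many rounds. In each round one party performs, on that party's own system, a generalized measurement with finitely many Kraus operators $W_x$ (possibly between spaces of different finite dimensions), $\sum_x W_x^\dagger W_x=I$, and announces the outcome $x$, on which the rest of the protocol may depend; at the end the pair is either kept or discarded, according to the record of the outcomes. $\Lambda(\varrho)$ is the sum of the unnormalized final states over the records for which the pair is kept, $\operatorname{Tr}\Lambda(\varrho)$ is the probability of success, and $\Lambda(\varrho)/\operatorname{Tr}\Lambda(\varrho)$ is the resulting state. The state $\varrho$ is called distillable if Alice and Bob can obtain arbitrarily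 many, arbitrarily good singlets from copies of it: for every $k\in\mathbb N$ and every $\varepsilon>0$ there are $n\in\mathbb N$ and an LQCC operation $\Lambda$ from $\mathcal H_A^{\otimes n}\otimes\mathcal H_B^{\otimes n}$ to $(\mathbb C^2)^{\otimes k}\otimes(\mathbb C^2)^{\otimes k}$ with $\operatorname{Tr}\Lambda(\varrho^{\otimes n})\neq0$ and $$\Bigl\langle\psi_-^{\otimes k}\Bigr|\frac{\Lambda(\varrho^{\otimes n})}{\operatorname{Tr}\Lambda(\varrho^{\otimes n})}\Bigl|\psi_-^{\otimes k}\Bigr\rangle>1-\varepsilon,\qquad \psi_-=\tfrac1{\sqrt2}\bigl(|01\rangle-|10\rangle\bigr).$$ **Theorem.** The state $\varrho$ is distillable if and only if there are $n\in\mathbb N$ and orthogonal projectors $P$ on $\mathcal H_A^{\otimes n}$ and $Q$ on $\mathcal H_B^{\otimes n}$, both of rank two, such that $(P\otimes Q)\,\varrho^{\otimes n}\,(P\otimes Q)$ is nonzero and, after normalization to trace $1$, is an entangled state. -/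

import Mathlib

open scoped Matrix Kronecker ComplexOrder

namespace Distill

/-- A state (density matrix) on the Hilbert space `ℂ^I`. -/
def IsState {I : Type} [Fintype I] (ρ : Matrix I I ℂ) : Prop :=
  ρ.PosSemidef ∧ ρ.trace = 1

/-- A separable state on `ℂ^A ⊗ ℂ^B`: a finite convex combination of product states. -/
def IsSeparable {A B : Type} [Fintype A] [Fintype B]
    (ρ : Matrix (A × B) (A × B) ℂ) : Prop :=
  ∃ (k : ℕ) (p : Fin k → ℝ) (σ : Fin k → Matrix A A ℂ) (τ : Fin k → Matrix B B ℂ),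
    (∀ i, 0 ≤ p i) ∧ ∑ i, p i = 1 ∧ (∀ i, IsState (σ i)) ∧ (∀ i, IsState (τ i)) ∧
      ρ = ∑ i, (p i : ℂ) • (σ i ⊗ₖ τ i)

/-- An entangled state on `ℂ^A ⊗ ℂ^B`: a state that is not separable. -/
def IsEntangled {A B : Type} [Fintype A] [Fintype B]
    (ρ : Matrix (A × B) (A × B) ℂ) : Prop :=
  IsState ρ ∧ ¬ IsSeparable ρ

/-- Division by the trace. For `X = 0` the result is `0`, which is not a state. -/
noncomputable def normalized {I : Type} [Fintype I] (X : Matrix I I ℂ) : Matrix I I ℂ :=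
  X.trace⁻¹ • X

/-- The `n`-fold tensor power `ρ^{⊗n}` of an operator on `ℂ^A ⊗ ℂ^B`, as an operator on
`(ℂ^A)^{⊗n} ⊗ (ℂ^B)^{⊗n}`: all `A`-factors are with Alice, all `B`-factors are with Bob. -/
def copies {A B : Type} (n : ℕ) (ρ : Matrix (A × B) (A × B) ℂ) :
    Matrix ((Fin n → A) × (Fin n → B)) ((Fin n → A) × (Fin n → B)) ℂ :=
  fun x y => ∏ i, ρ (x.1 i, x.2 i) (y.1 i, y.2 i)

/-- A two-dimensional (orthogonal) projector on `ℂ^I`. -/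
def IsTwoDimProjector {I : Type} [Fintype I] (P : Matrix I I ℂ) : Prop :=
  P.IsHermitian ∧ P * P = P ∧ P.rank = 2

/-- The LQCC operations (local quantum operations and classical communication), including
post-selection on the classical record, in the Schrödinger picture and before normalisation.

A protocol has finitely many rounds. In one round, one party performs a generalised
measurement on that party's own system, with Kraus operators `W x` that satisfy
`∑ x, (W x)ᴴ * W x = 1`, and tells the other party the outcome `x`; the remaining protocol
may depend on `x`. The operators `W x` may be rectangular, so that local ancillas can be added
and local subsystems measured or discarded. When the protocol stops, the parties either keep
the pair (`keep`) or declare a failure (`fail`). The operation sums over all the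
records that end in `keep`, so that `(Λ ρ).trace` is the probability of success,
and `normalized (Λ ρ)` the resulting state in the case of success. -/
inductive IsLQCC : ∀ {A B A' B' : Type} [Fintype A] [DecidableEq A] [Fintype B] [DecidableEq B]
    [Fintype A'] [DecidableEq A'] [Fintype B'] [DecidableEq B'],
    (Matrix (A × B) (A × B) ℂ → Matrix (A' × B') (A' × B') ℂ) → Prop
  | keep {A B : Type} [Fintype A] [DecidableEq A] [Fintype B] [DecidableEq B] :
      IsLQCC (fun ρ : Matrix (A × B) (A × B) ℂ => ρ)
  | fail {A B A' B' : Type} [Fintype A] [DecidableEq A] [Fintype B] [DecidableEq B]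
      [Fintype A'] [DecidableEq A'] [Fintype B'] [DecidableEq B'] :
      IsLQCC (fun _ : Matrix (A × B) (A × B) ℂ => (0 : Matrix (A' × B') (A' × B') ℂ))
  | alice {A B A₁ A' B' X : Type} [Fintype A] [DecidableEq A] [Fintype B] [DecidableEq B]
      [Fintype A₁] [DecidableEq A₁] [Fintype A'] [DecidableEq A'] [Fintype B'] [DecidableEq B']
      [Fintype X] (W : X → Matrix A₁ A ℂ) (hW : ∑ x, (W x)ᴴ * W x = 1)
      (Λ : X → Matrix (A₁ × B) (A₁ × B) ℂ → Matrix (A' × B') (A' × B') ℂ)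
      (hΛ : ∀ x, IsLQCC (Λ x)) :
      IsLQCC (fun ρ : Matrix (A × B) (A × B) ℂ =>
        ∑ x, Λ x ((W x ⊗ₖ (1 : Matrix B B ℂ)) * ρ * (W x ⊗ₖ (1 : Matrix B B ℂ))ᴴ))
  | bob {A B B₁ A' B' X : Type} [Fintype A] [DecidableEq A] [Fintype B] [DecidableEq B]
      [Fintype B₁] [DecidableEq B₁] [Fintype A'] [DecidableEq A'] [Fintype B'] [DecidableEq B']
      [Fintype X] (W : X → Matrix B₁ B ℂ) (hW : ∑ x, (W x)ᴴ * W x = 1)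
      (Λ : X → Matrix (A × B₁) (A × B₁) ℂ → Matrix (A' × B') (A' × B') ℂ)
      (hΛ : ∀ x, IsLQCC (Λ x)) :
      IsLQCC (fun ρ : Matrix (A × B) (A × B) ℂ =>
        ∑ x, Λ x (((1 : Matrix A A ℂ) ⊗ₖ W x) * ρ * ((1 : Matrix A A ℂ) ⊗ₖ W x)ᴴ))

/-- The singlet vector `ψ₋ = (|01⟩ - |10⟩) / √2` of two qubits. -/
noncomputable def singletVec : Fin 2 × Fin 2 → ℂ := fun x =>
  if x = (0, 1) then ((Real.sqrt 2)⁻¹ : ℝ) else if x = (1, 0) then -((Real.sqrt 2)⁻¹ : ℝ) else 0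

/-- The singlet state `|ψ₋⟩⟨ψ₋|`. -/
noncomputable def singlet : Matrix (Fin 2 × Fin 2) (Fin 2 × Fin 2) ℂ :=
  Matrix.vecMulVec singletVec (star singletVec)

/-- The fidelity `⟨ψ₋^{⊗k}| σ |ψ₋^{⊗k}⟩` of a state of `k` qubit pairs with `k` singlets. -/
noncomputable def singletFidelity (k : ℕ)
    (σ : Matrix ((Fin k → Fin 2) × (Fin k → Fin 2)) ((Fin k → Fin 2) × (Fin k → Fin 2)) ℂ) : ℝ :=
  (σ * copies k singlet).trace.re

/-- The state `ρ` can be distilled: any number `k` of pairs, in a joint state arbitrarily close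
to `k` singlets, can be obtained by an LQCC operation (that succeeds with nonzero
probability) from sufficiently many pairs, each in the state `ρ`. -/
def IsDistillable {A B : Type} [Fintype A] [DecidableEq A] [Fintype B] [DecidableEq B]
    (ρ : Matrix (A × B) (A × B) ℂ) : Prop :=
  ∀ (k : ℕ) (ε : ℝ), 0 < ε →
    ∃ (n : ℕ) (Λ : Matrix ((Fin n → A) × (Fin n → B)) ((Fin n → A) × (Fin n → B)) ℂ →
        Matrix ((Fin k → Fin 2) × (Fin k → Fin 2)) ((Fin k → Fin 2) × (Fin k → Fin 2)) ℂ),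
      IsLQCC Λ ∧ (Λ (copies n ρ)).trace ≠ 0 ∧
        1 - ε < singletFidelity k (normalized (Λ (copies n ρ)))

end Distill

/-!
Only completely positive maps of the form `∑ x, (a x ⊗ b x) · (a x ⊗ b x)ᴴ` matter: every LQCC
operation has this form (`IsLQCC.exists_kraus`), and since failure is allowed and only a nonzero
probability of success is asked for, every such map is an LQCC operation up to a positive factor
(`SepTo.exists_isLQCC`).

If `ρ` is distillable, some LQCC operation yields a single pair with singlet fidelity above `1 / 2`,
and then a single one of its Kraus operators `a ⊗ b` does (`IsDistillable.exists_entGap_neg`).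
Products have fidelity at most `1 / 2`, so `a` and `b` have rank two, and their support projectors
`P` and `Q` leave `ρ^{⊗n}` entangled: otherwise `a ⊗ b` would map a separable operator to one
with fidelity above `1 / 2`.

Conversely, an entangled projection of `ρ^{⊗n}` is an entangled operator `Z` on two qubits. Write
`Z = ∑ j, |m j⟩⟨m j|` with four `2 × 2` matrices `m j`; such a vector is a product if and only if
`det (m j) = 0`. By Takagi's factorization (`exists_orthonormal_antilinear_eigenvectors`) the `m j`
may be taken to be orthogonal for the polarized determinant, with values `s j ≥ 0`. If no `s j`
exceeds the sum of the others, the `s j` are the sides of a closed quadrilateral, and mixing the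
`m j` with the corresponding phases and a Hadamard matrix gives four product vectors, so that `Z` is
separable (`exists_det_eq_zero_family`). Otherwise a local filter turns the dominant vector into a
maximally entangled one and the others into multiples of traceless unitaries, which makes the
fidelity exceed `1 / 2` (`exists_filter_of_lt`). Both steps are for positive definite `Z`; the
general case follows since sums of four product vectors form a closed set
(`exists_family_or_filter`).

From pairs with fidelity above `1 / 2`, made Bell-diagonal by a twirl, good singlets are obtained by
postselection in two rounds. The local projection onto the span of the `|aa⟩` takes the entrywise
product of two operators, so that comparing many pairs in the computational basis takes an entrywise
power of `bell u v w z` and suppresses the bit flips exponentially, as `w < v`; after a Hadamard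
gate a second power suppresses the phase flips (`exists_pow_fidelity`). Running this in parallel gives
any number of singlets (`isDistillable_of_reach`).
-/

namespace Distill

/-! ### Stochastic separable maps -/

open scoped MatrixOrder in
lemma exists_eq_conjTranspose_mul_self {I : Type} [Fintype I] [DecidableEq I]
    {M : Matrix I I ℂ} (hM : M.PosSemidef) : ∃ B : Matrix I I ℂ, M = Bᴴ * B :=
  CStarAlgebra.nonneg_iff_eq_star_mul_self.mp hM.nonneg

/-- The action of the product Kraus operator `a ⊗ b`. -/
def prodConj {A B A' B' : Type} [Fintype A] [Fintype B]
    (a : Matrix A' A ℂ) (b : Matrix B' B ℂ) (T : Matrix (A × B) (A × B) ℂ) :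
    Matrix (A' × B') (A' × B') ℂ :=
  (a ⊗ₖ b) * T * (a ⊗ₖ b)ᴴ

/-- `SepTo T Y` says that `Y` is the image of `T` under a separable map
`∑ x, (a x ⊗ b x) · (a x ⊗ b x)ᴴ`, with no condition on the sum `∑ x, (a x ⊗ b x)ᴴ (a x ⊗ b x)`. -/
def SepTo {A B A' B' : Type} [Fintype A] [Fintype B]
    (T : Matrix (A × B) (A × B) ℂ) (Y : Matrix (A' × B') (A' × B') ℂ) : Prop :=
  ∃ (X : Type) (_ : Fintype X) (a : X → Matrix A' A ℂ) (b : X → Matrix B' B ℂ),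
    Y = ∑ x, prodConj (a x) (b x) T

section prodConj

variable {A B A' B' A'' B'' : Type} [Fintype A] [Fintype B]

lemma prodConj_prodConj [Fintype A'] [Fintype B'] (a : Matrix A' A ℂ) (b : Matrix B' B ℂ)
    (a' : Matrix A'' A' ℂ)
    (b' : Matrix B'' B' ℂ) (T : Matrix (A × B) (A × B) ℂ) :
    prodConj a' b' (prodConj a b T) = prodConj (a' * a) (b' * b) T := by
  simp only [prodConj, Matrix.mul_kronecker_mul, Matrix.conjTranspose_mul, Matrix.mul_assoc]

lemma prodConj_sum {X : Type} [Fintype X] (a : Matrix A' A ℂ) (b : Matrix B' B ℂ)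
    (T : X → Matrix (A × B) (A × B) ℂ) :
    prodConj a b (∑ x, T x) = ∑ x, prodConj a b (T x) := by
  simp only [prodConj, Matrix.mul_sum, Matrix.sum_mul]

lemma prodConj_kronecker (a : Matrix A' A ℂ) (b : Matrix B' B ℂ) (S : Matrix A A ℂ)
    (T : Matrix B B ℂ) : prodConj a b (S ⊗ₖ T) = (a * S * aᴴ) ⊗ₖ (b * T * bᴴ) := by
  simp only [prodConj, Matrix.mul_kronecker_mul, Matrix.conjTranspose_kronecker]

lemma prodConj_smul_smul (c d : ℂ) (a : Matrix A' A ℂ) (b : Matrix B' B ℂ)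
    (T : Matrix (A × B) (A × B) ℂ) :
    prodConj (c • a) (d • b) T = (c * d * star (c * d)) • prodConj a b T := by
  simp only [prodConj, Matrix.smul_kronecker, Matrix.kronecker_smul, Matrix.conjTranspose_smul,
    Matrix.smul_mul, Matrix.mul_smul, smul_smul]
  congr 1
  simp only [star_mul]
  ring

lemma prodConj_posSemidef [Finite A'] [Finite B'] (a : Matrix A' A ℂ) (b : Matrix B' B ℂ)
    {T : Matrix (A × B) (A × B) ℂ}
    (hT : T.PosSemidef) : (prodConj a b T).PosSemidef :=
  hT.mul_mul_conjTranspose_same _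

lemma prodConj_one_one [DecidableEq A] [DecidableEq B] (T : Matrix (A × B) (A × B) ℂ) :
    prodConj (1 : Matrix A A ℂ) (1 : Matrix B B ℂ) T = T := by
  simp [prodConj]

end prodConj

lemma SepTo.single {A B A' B' : Type} [Fintype A] [Fintype B]
    (a : Matrix A' A ℂ) (b : Matrix B' B ℂ) (T : Matrix (A × B) (A × B) ℂ) :
    SepTo T (prodConj a b T) :=
  ⟨Unit, inferInstance, fun _ => a, fun _ => b, by simp⟩

lemma SepTo.trans {A B A' B' A'' B'' : Type} [Fintype A] [Fintype B] [Fintype A'] [Fintype B']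
    {T : Matrix (A × B) (A × B) ℂ} {Y : Matrix (A' × B') (A' × B') ℂ}
    {Z : Matrix (A'' × B'') (A'' × B'') ℂ} (h₁ : SepTo T Y) (h₂ : SepTo Y Z) : SepTo T Z := by
  obtain ⟨X, _, a, b, rfl⟩ := h₁
  obtain ⟨X', _, a', b', rfl⟩ := h₂
  refine ⟨X' × X, inferInstance, fun x => a' x.1 * a x.2, fun x => b' x.1 * b x.2, ?_⟩
  simp only [prodConj_sum, prodConj_prodConj, Fintype.sum_prod_type]

lemma SepTo.add {A B A' B' : Type} [Fintype A] [Fintype B]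
    {T : Matrix (A × B) (A × B) ℂ} {Y Z : Matrix (A' × B') (A' × B') ℂ}
    (h₁ : SepTo T Y) (h₂ : SepTo T Z) : SepTo T (Y + Z) := by
  obtain ⟨X, _, a, b, rfl⟩ := h₁
  obtain ⟨X', _, a', b', rfl⟩ := h₂
  exact ⟨X ⊕ X', inferInstance, Sum.elim a a', Sum.elim b b', by simp⟩

/-- Local monomial operators: relabelling of the basis, combined with phases, amplitudes, and
projection onto the span of a set of basis vectors. -/
lemma SepTo.pullback {A B A' B' : Type} [Fintype A] [Fintype B]
    (f : A' → A) (g : B' → B) (s : A' → ℂ) (t : B' → ℂ)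
    {T : Matrix (A × B) (A × B) ℂ} {Y : Matrix (A' × B') (A' × B') ℂ}
    (h : ∀ x y, Y x y = s x.1 * t x.2 * T (f x.1, g x.2) (f y.1, g y.2) * star (s y.1 * t y.2)) :
    SepTo T Y := by
  classical
  suffices h' : Y = prodConj (Matrix.of fun i j => if f i = j then s i else 0)
      (Matrix.of fun i j => if g i = j then t i else 0) T by
    rw [h']
    exact SepTo.single _ _ T
  ext ⟨x, y⟩ ⟨z, w⟩
  rw [h]
  simp [prodConj, Matrix.mul_apply, Fintype.sum_prod_type, apply_ite]

lemma SepTo.monomial {A B A' B' : Type} [Fintype A] [Fintype B]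
    (f : A' → A) (g : B' → B) (s : A' → ℂ) (t : B' → ℂ) (T : Matrix (A × B) (A × B) ℂ) :
    SepTo T (Matrix.of fun x y : A' × B' =>
      s x.1 * t x.2 * T (f x.1, g x.2) (f y.1, g y.2) * star (s y.1 * t y.2)) :=
  SepTo.pullback f g s t fun _ _ => rfl

/-- The tensor product of two bipartite operators, as a bipartite operator. -/
def bitensor {A B C D : Type} (T : Matrix (A × B) (A × B) ℂ) (S : Matrix (C × D) (C × D) ℂ) :
    Matrix ((A × C) × (B × D)) ((A × C) × (B × D)) ℂ :=
  fun x y => T (x.1.1, x.2.1) (y.1.1, y.2.1) * S (x.1.2, x.2.2) (y.1.2, y.2.2)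

lemma bitensor_prodConj {A B C D A' B' C' D' : Type} [Fintype A] [Fintype B] [Fintype C]
    [Fintype D] (a : Matrix A' A ℂ) (b : Matrix B' B ℂ) (c : Matrix C' C ℂ) (d : Matrix D' D ℂ)
    (T : Matrix (A × B) (A × B) ℂ) (S : Matrix (C × D) (C × D) ℂ) :
    bitensor (prodConj a b T) (prodConj c d S) =
      prodConj (a ⊗ₖ c) (b ⊗ₖ d) (bitensor T S) := by
  let e : (A × B) × (C × D) ≃ (A × C) × (B × D) := Equiv.prodProdProdComm A B C D
  let e' : (A' × B') × (C' × D') ≃ (A' × C') × (B' × D') := Equiv.prodProdProdComm A' B' C' D'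
  have h1 : bitensor T S = (T ⊗ₖ S).submatrix e.symm e.symm := rfl
  have h2 : bitensor (prodConj a b T) (prodConj c d S)
      = (prodConj a b T ⊗ₖ prodConj c d S).submatrix e'.symm e'.symm := rfl
  have h3 : (a ⊗ₖ c) ⊗ₖ (b ⊗ₖ d) = ((a ⊗ₖ b) ⊗ₖ (c ⊗ₖ d)).submatrix e'.symm e.symm := by
    ext ⟨⟨_, _⟩, _, _⟩ ⟨⟨_, _⟩, _, _⟩
    simp [e, e', Matrix.kroneckerMap_apply, Equiv.prodProdProdComm, mul_mul_mul_comm]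
  rw [h2, h1, prodConj, prodConj, prodConj, h3, Matrix.conjTranspose_submatrix,
    Matrix.submatrix_mul_equiv, Matrix.submatrix_mul_equiv, Matrix.mul_kronecker_mul,
    Matrix.mul_kronecker_mul, Matrix.conjTranspose_kronecker (a ⊗ₖ b)]

lemma SepTo.bitensor {A B C D A' B' C' D' : Type} [Fintype A] [Fintype B] [Fintype C] [Fintype D]
    {T : Matrix (A × B) (A × B) ℂ} {S : Matrix (C × D) (C × D) ℂ}
    {T' : Matrix (A' × B') (A' × B') ℂ} {S' : Matrix (C' × D') (C' × D') ℂ}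
    (hT : SepTo T T') (hS : SepTo S S') : SepTo (bitensor T S) (bitensor T' S') := by
  obtain ⟨X, _, a, b, rfl⟩ := hT
  obtain ⟨X', _, c, d, rfl⟩ := hS
  refine ⟨X × X', inferInstance, fun x => a x.1 ⊗ₖ c x.2, fun x => b x.1 ⊗ₖ d x.2, ?_⟩
  simp only [← bitensor_prodConj, Fintype.sum_prod_type]
  ext x y
  simp only [Distill.bitensor, Matrix.sum_apply, Finset.sum_mul_sum]

/-! ### Tensor powers -/

lemma copies_mul {A B : Type} [Fintype A] [Fintype B] (n : ℕ) (S T : Matrix (A × B) (A × B) ℂ) :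
    copies n S * copies n T = copies n (S * T) := by
  ext x y
  simp only [copies, Matrix.mul_apply, Finset.prod_univ_sum, Fintype.piFinset_univ,
    ← Finset.prod_mul_distrib]
  exact (Fintype.sum_equiv (Equiv.arrowProdEquivProdArrow (Fin n) (fun _ => A) fun _ => B)
    _ _ (fun _ => rfl)).symm

lemma trace_copies {A B : Type} [Fintype A] [Fintype B] (n : ℕ) (T : Matrix (A × B) (A × B) ℂ) :
    (copies n T).trace = T.trace ^ n := by
  have h : T.trace ^ n = ∏ _i : Fin n, ∑ x, T x x := by
    simp [Matrix.trace]
  rw [h, Finset.prod_univ_sum, Fintype.piFinset_univ]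
  exact (Fintype.sum_equiv (Equiv.arrowProdEquivProdArrow (Fin n) (fun _ => A) fun _ => B)
    _ _ (fun _ => rfl)).symm

lemma copies_posSemidef {A B : Type} [Fintype A] [Fintype B] [DecidableEq A] [DecidableEq B]
    (n : ℕ) {T : Matrix (A × B) (A × B) ℂ} (hT : T.PosSemidef) : (copies n T).PosSemidef := by
  obtain ⟨S, rfl⟩ := exists_eq_conjTranspose_mul_self hT
  have h : copies n Sᴴ = (copies n S)ᴴ := by
    ext x y
    simp [copies]
  rw [← copies_mul, h]
  exact Matrix.posSemidef_conjTranspose_mul_self _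

/-- `Reach ρ Y`: some number of copies of `ρ` can be turned into `Y` by a separable map. -/
def Reach {A B A' B' : Type} [Fintype A] [Fintype B] (ρ : Matrix (A × B) (A × B) ℂ)
    (Y : Matrix (A' × B') (A' × B') ℂ) : Prop :=
  ∃ n : ℕ, SepTo (copies n ρ) Y

section Reach

variable {A B : Type} [Fintype A] [Fintype B] {ρ : Matrix (A × B) (A × B) ℂ}

lemma Reach.trans {A' B' A'' B'' : Type} [Fintype A'] [Fintype B']
    {Y : Matrix (A' × B') (A' × B') ℂ} {Z : Matrix (A'' × B'') (A'' × B'') ℂ}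
    (h : Reach ρ Y) (h' : SepTo Y Z) : Reach ρ Z :=
  h.imp fun _ h => h.trans h'

lemma Reach.bitensor {A' B' C D : Type}
    {Y : Matrix (A' × B') (A' × B') ℂ} {Z : Matrix (C × D) (C × D) ℂ}
    (hY : Reach ρ Y) (hZ : Reach ρ Z) : Reach ρ (bitensor Y Z) := by
  obtain ⟨n, hn⟩ := hY
  obtain ⟨m, hm⟩ := hZ
  refine ⟨n + m, SepTo.trans ?_ (hn.bitensor hm)⟩
  refine SepTo.pullback (fun x : (Fin n → A) × (Fin m → A) => Fin.append x.1 x.2)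
    (fun x : (Fin n → B) × (Fin m → B) => Fin.append x.1 x.2) (fun _ => 1) (fun _ => 1)
    fun x y => ?_
  simp [Distill.bitensor, copies, Fin.prod_univ_add]

/-- Two pairs are turned into one by the local projections onto the span of the vectors `aa`. -/
lemma Reach.hadamard {A' B' : Type} [Fintype A'] [Fintype B'] {Y Z : Matrix (A' × B') (A' × B') ℂ}
    (hY : Reach ρ Y) (hZ : Reach ρ Z) : Reach ρ (Y ⊙ Z) := by
  refine (hY.bitensor hZ).trans ?_
  refine SepTo.pullback (fun x : A' => (x, x)) (fun x : B' => (x, x)) (fun _ => 1) (fun _ => 1)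
    fun x y => ?_
  simp [Distill.bitensor]

lemma Reach.copies {A' B' : Type} [Fintype A'] [Fintype B'] {Y : Matrix (A' × B') (A' × B') ℂ}
    (hY : Reach ρ Y) (k : ℕ) : Reach ρ (copies k Y) := by
  induction k with
  | zero =>
    refine ⟨0, ?_⟩
    refine SepTo.pullback (fun _ : Fin 0 → A' => (Fin.elim0 : Fin 0 → A))
      (fun _ : Fin 0 → B' => (Fin.elim0 : Fin 0 → B)) (fun _ => 1) (fun _ => 1)
      fun x y => ?_
    simp [Distill.copies]
  | succ k ih =>
    refine (hY.bitensor ih).trans ?_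
    refine SepTo.pullback (fun x : Fin (k + 1) → A' => (x 0, Fin.tail x))
      (fun x : Fin (k + 1) → B' => (x 0, Fin.tail x)) (fun _ => 1) (fun _ => 1)
      fun x y => ?_
    simp [Distill.copies, Distill.bitensor, Fin.prod_univ_succ, Fin.tail]

end Reach

/-! ### LQCC operations and separable maps -/

/-- Every LQCC operation is a separable map. -/
lemma IsLQCC.exists_kraus {A B A' B' : Type} [Fintype A] [DecidableEq A] [Fintype B]
    [DecidableEq B] [Fintype A'] [DecidableEq A'] [Fintype B'] [DecidableEq B']
    {Λ : Matrix (A × B) (A × B) ℂ → Matrix (A' × B') (A' × B') ℂ} (h : IsLQCC Λ) :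
    ∃ (X : Type) (_ : Fintype X) (a : X → Matrix A' A ℂ) (b : X → Matrix B' B ℂ),
      ∀ T, Λ T = ∑ x, prodConj (a x) (b x) T := by
  induction h with
  | keep => exact ⟨Unit, inferInstance, fun _ => 1, fun _ => 1, fun T => by
      simp [prodConj_one_one]⟩
  | fail => exact ⟨Empty, inferInstance, Empty.elim, Empty.elim, fun T => by simp⟩
  | alice W hW Λ hΛ ih =>
    choose X hX a b hab using ih
    refine ⟨Σ x, X x, inferInstance, fun p => a p.1 p.2 * W p.1, fun p => b p.1 p.2, fun T => ?_⟩
    rw [Fintype.sum_sigma]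
    refine Finset.sum_congr rfl fun x _ => (hab x _).trans (Finset.sum_congr rfl fun y _ => ?_)
    exact (prodConj_prodConj _ _ _ _ _).trans (by rw [Matrix.mul_one])
  | bob W hW Λ hΛ ih =>
    choose X hX a b hab using ih
    refine ⟨Σ x, X x, inferInstance, fun p => a p.1 p.2, fun p => b p.1 p.2 * W p.1, fun T => ?_⟩
    rw [Fintype.sum_sigma]
    refine Finset.sum_congr rfl fun x _ => (hab x _).trans (Finset.sum_congr rfl fun y _ => ?_)
    exact (prodConj_prodConj _ _ _ _ _).trans (by rw [Matrix.mul_one])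

open scoped MatrixOrder Matrix.Norms.L2Operator in
lemma exists_posSemidef_smul_one_sub {I : Type} [Fintype I] [DecidableEq I]
    {H : Matrix I I ℂ} (hH : H.PosSemidef) :
    ∃ r : ℝ, 0 < r ∧ ((r : ℂ) • (1 : Matrix I I ℂ) - H).PosSemidef := by
  refine ⟨‖H‖ + 1, by positivity, ?_⟩
  have h : H ≤ algebraMap ℝ (Matrix I I ℂ) ‖H‖ :=
    IsSelfAdjoint.le_algebraMap_norm_self hH.isHermitian
  have h' := (Matrix.le_iff.mp h).add (Matrix.PosSemidef.one (n := I) (R := ℂ))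
  have e : ((‖H‖ + 1 : ℝ) : ℂ) • (1 : Matrix I I ℂ) - H =
      algebraMap ℝ (Matrix I I ℂ) ‖H‖ - H + 1 := by
    rw [Algebra.algebraMap_eq_smul_one, Complex.ofReal_add, add_smul, Complex.ofReal_one, one_smul,
      Complex.coe_smul]
    abel
  rw [e]
  exact h'

/-- A finite family of operators becomes, up to a common factor, part of a generalized
measurement. The further Kraus operators have the same output space, as a round of a protocol
demands: each has a single nonzero row. -/
lemma exists_completion {A A' X : Type} [Fintype A] [DecidableEq A] [Fintype A'] [DecidableEq A']
    [Nonempty A'] [Fintype X] (a : X → Matrix A' A ℂ) :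
    ∃ (c : ℝ) (k : A → Matrix A' A ℂ), 0 < c ∧
      ∑ x, ((c : ℂ) • a x)ᴴ * ((c : ℂ) • a x) + ∑ y, (k y)ᴴ * k y = 1 := by
  obtain ⟨r, hr, hps⟩ := exists_posSemidef_smul_one_sub
    (Matrix.posSemidef_sum Finset.univ fun x _ => Matrix.posSemidef_conjTranspose_mul_self (a x))
  obtain ⟨S, hS⟩ := exists_eq_conjTranspose_mul_self hps
  let o : A' := Classical.arbitrary A'
  set c : ℝ := (Real.sqrt r)⁻¹ with hc
  have hcpos : 0 < c := inv_pos.mpr (Real.sqrt_pos.mpr hr)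
  have hcc : (c : ℂ) * c * r = 1 := by
    have : c * c * r = 1 := by
      rw [hc, ← mul_inv, Real.mul_self_sqrt hr.le, inv_mul_cancel₀ hr.ne']
    exact_mod_cast this
  refine ⟨c, fun y => Matrix.of fun i j => if i = o then c * S y j else 0, hcpos, ?_⟩
  have h1 : ∑ y, (Matrix.of fun (i : A') j => if i = o then c * S y j else 0)ᴴ *
      (Matrix.of fun i j => if i = o then c * S y j else 0) = ((c : ℂ) * c) • (Sᴴ * S) := by
    ext i j
    simp only [Matrix.sum_apply, Matrix.mul_apply, Matrix.conjTranspose_apply, Matrix.of_apply,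
      Matrix.smul_apply, smul_eq_mul, Finset.mul_sum]
    refine Finset.sum_congr rfl fun y _ => ?_
    simp [apply_ite]
    ring
  rw [h1, ← hS]
  simp only [Matrix.conjTranspose_smul, Matrix.smul_mul, Matrix.mul_smul, smul_smul,
    ← Finset.smul_sum, smul_sub, hcc, one_smul]
  simp

/-- Every separable map is, up to a positive factor, an LQCC operation with post-selection:
Alice measures the operators `a x` together with a completion and announces `x`, Bob then applies
`b x` in the same way, and the pair is kept if neither outcome belongs to the completions. -/
lemma SepTo.exists_isLQCC {A B A' B' : Type} [Fintype A] [DecidableEq A] [Fintype B]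
    [DecidableEq B] [Fintype A'] [DecidableEq A'] [Fintype B'] [DecidableEq B'] [Nonempty A']
    [Nonempty B'] {T : Matrix (A × B) (A × B) ℂ} {Y : Matrix (A' × B') (A' × B') ℂ}
    (h : SepTo T Y) :
    ∃ (Λ : Matrix (A × B) (A × B) ℂ → Matrix (A' × B') (A' × B') ℂ) (c : ℝ),
      IsLQCC Λ ∧ 0 < c ∧ Λ T = (c : ℂ) • Y := by
  obtain ⟨X, _, a, b, rfl⟩ := h
  obtain ⟨c, k, hc, hk⟩ := exists_completion a
  obtain ⟨d, l, hd, hl⟩ := exists_completion b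
  have key (x : X) : ∃ Λ : Matrix (A' × B) (A' × B) ℂ → Matrix (A' × B') (A' × B') ℂ,
      IsLQCC Λ ∧ ∀ S, Λ S = prodConj 1 ((d : ℂ) • b x) S := by
    refine ⟨_, IsLQCC.bob (Sum.elim (fun x => (d : ℂ) • b x) l) (by simpa using hl)
      (Sum.elim (fun y S => by classical exact if y = x then S else 0) fun _ _ => 0) ?_, ?_⟩
    · rintro (y | y)
      · by_cases hy : y = x
        · simpa [hy] using IsLQCC.keep
        · simpa [hy] using IsLQCC.fail
      · exact IsLQCC.fail
    · intro S
      classical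
      simp only [Fintype.sum_sum_type, Sum.elim_inl, Sum.elim_inr, Finset.sum_const_zero, add_zero,
        Finset.sum_ite_eq', Finset.mem_univ, if_true]
      rfl
  choose Λ hΛ hΛ' using key
  refine ⟨_, (c * d) ^ 2, IsLQCC.alice (Sum.elim (fun x => (c : ℂ) • a x) k) (by simpa using hk)
    (Sum.elim Λ fun _ _ => 0) ?_, by positivity, ?_⟩
  · rintro (y | y)
    · exact hΛ y
    · exact IsLQCC.fail
  · simp only [Fintype.sum_sum_type, Sum.elim_inl, Sum.elim_inr, Finset.sum_const_zero, add_zero,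
      hΛ', Finset.smul_sum]
    refine Finset.sum_congr rfl fun x _ => ?_
    refine (prodConj_prodConj ((c : ℂ) • a x) 1 1 ((d : ℂ) • b x) T).trans ?_
    rw [Matrix.one_mul, Matrix.mul_one, prodConj_smul_smul]
    congr 1
    simp
    ring

/-! ### Bell-diagonal operators -/

lemma SepTo.posSemidef {A B A' B' : Type} [Fintype A] [Fintype B] [Fintype A'] [Fintype B']
    {T : Matrix (A × B) (A × B) ℂ} {Y : Matrix (A' × B') (A' × B') ℂ} (h : SepTo T Y)
    (hT : T.PosSemidef) : Y.PosSemidef := by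
  obtain ⟨X, _, a, b, rfl⟩ := h
  exact Matrix.posSemidef_sum _ fun x _ => prodConj_posSemidef _ _ hT

/-- The operator on two qubits that is diagonal in the Bell basis, with diagonal entries `u` at
`00`, `11` and `w` at `01`, `10`, and with antidiagonal entries `v` and `z` respectively. Its
eigenvalues are `u + v`, `u - v`, `w + z`, `w - z`. -/
def bell (u v w z : ℝ) : Matrix (Fin 2 × Fin 2) (Fin 2 × Fin 2) ℂ := fun x y =>
  if x = y then (if x.1 = x.2 then u else w)
  else if x.1 ≠ y.1 ∧ x.2 ≠ y.2 then (if x.1 = x.2 then v else z) else 0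

lemma bell_hadamard_bell (u v w z u' v' w' z' : ℝ) :
    bell u v w z ⊙ bell u' v' w' z' = bell (u * u') (v * v') (w * w') (z * z') := by
  ext x y
  simp only [bell, Matrix.hadamard_apply]
  split_ifs <;> simp

lemma Reach.bell_pow {A B : Type} [Fintype A] [Fintype B] {ρ : Matrix (A × B) (A × B) ℂ}
    {u v w z : ℝ} (h : Reach ρ (bell u v w z)) (n : ℕ) :
    Reach ρ (bell (u ^ (n + 1)) (v ^ (n + 1)) (w ^ (n + 1)) (z ^ (n + 1))) := by
  induction n with
  | zero => simpa using h
  | succ n ih => simpa only [pow_succ _ (n + 1), bell_hadamard_bell] using ih.hadamard h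

/-- The twirl over the four operations `P ⊗ P`, with `P` a Pauli operator, makes an operator on two
qubits diagonal in the Bell basis. -/
lemma SepTo.twirl {X : Matrix (Fin 2 × Fin 2) (Fin 2 × Fin 2) ℂ} (hX : X.IsHermitian) :
    SepTo X (bell (2 * (X (0, 0) (0, 0) + X (1, 1) (1, 1)).re) (4 * (X (0, 0) (1, 1)).re)
      (2 * (X (0, 1) (0, 1) + X (1, 0) (1, 0)).re) (4 * (X (0, 1) (1, 0)).re)) := by
  let id' : Fin 2 → Fin 2 := ![0, 1]
  let fl : Fin 2 → Fin 2 := ![1, 0]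
  let sg : Fin 2 → ℂ := ![1, -1]
  have h := (((SepTo.monomial id' id' 1 1 X).add (SepTo.monomial id' id' sg sg X)).add
    (SepTo.monomial fl fl 1 1 X)).add (SepTo.monomial fl fl sg sg X)
  convert h using 1
  clear h
  have hr (x : Fin 2 × Fin 2) : ((X x x).re : ℂ) = X x x := by
    have := hX.apply x x
    exact Complex.conj_eq_iff_re.mp this
  have hd (x y : Fin 2 × Fin 2) : 2 * ((X x y).re : ℂ) = X x y + X y x := by
    have := (Complex.add_conj (X x y)).symm
    rw [← hX.apply y x]
    simpa using this
  have h1 := hr (0, 0)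
  have h2 := hr (1, 1)
  have h3 := hr (0, 1)
  have h4 := hr (1, 0)
  have h5 := hd (0, 0) (1, 1)
  have h6 := hd (0, 1) (1, 0)
  ext ⟨i, j⟩ ⟨k, l⟩
  fin_cases i <;> fin_cases j <;> fin_cases k <;> fin_cases l <;>
    simp [bell, id', fl, sg] <;> first | ring1 | linear_combination 2 * h1 + 2 * h2 |
      linear_combination 2 * h3 + 2 * h4 | linear_combination 2 * h5 | linear_combination 2 * h6

/-- The Hadamard gate on both sides exchanges bit flips and phase flips. -/
lemma SepTo.hadamardGate (u v w z : ℝ) :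
    SepTo (bell u v w z) (bell (2 * (u + v + w + z)) (2 * (u + v - w - z)) (2 * (u - v + w - z))
      (2 * (u - v - w + z))) := by
  convert SepTo.single !![1, 1; 1, -1] !![1, 1; 1, -1] (bell u v w z) using 1
  ext ⟨i, j⟩ ⟨k, l⟩
  fin_cases i <;> fin_cases j <;> fin_cases k <;> fin_cases l <;>
    simp [bell, prodConj, Matrix.mul_apply, Fintype.sum_prod_type, Matrix.kroneckerMap_apply] <;>
    ring

lemma bell_posSemidef {u v w z : ℝ} (h : (bell u v w z).PosSemidef) : v ≤ u ∧ |z| ≤ w := by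
  have key (f : Fin 2 × Fin 2 → ℂ) := h.re_dotProduct_nonneg f
  have h1 := key fun x => if x = (0, 0) then 1 else if x = (1, 1) then -1 else 0
  have h2 := key fun x => if x = (0, 1) then 1 else if x = (1, 0) then -1 else 0
  have h3 := key fun x => if x = (0, 1) then 1 else if x = (1, 0) then 1 else 0
  simp [dotProduct, Matrix.mulVec, Fintype.sum_prod_type, bell] at h1 h2 h3
  refine ⟨by linarith, abs_le.mpr ⟨by linarith, by linarith⟩⟩

/-- Applying `|0⟩ ↦ -|1⟩`, `|1⟩ ↦ |0⟩` on one side turns the maximally entangled vector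
`(|00⟩ + |11⟩) / √2` into the singlet. -/
lemma SepTo.bell_singlet (u v w z : ℝ) :
    ∃ Z : Matrix (Fin 2 × Fin 2) (Fin 2 × Fin 2) ℂ, SepTo (bell u v w z) Z ∧
      Z.trace = ((2 * u + 2 * w : ℝ) : ℂ) ∧ (Z * singlet).trace = ((u + v : ℝ) : ℂ) := by
  refine ⟨_, SepTo.monomial ![0, 1] ![1, 0] ![1, 1] ![1, -1] _, ?_, ?_⟩
  · simp [Matrix.trace, Fintype.sum_prod_type, bell]
    ring
  · have hs : (((Real.sqrt 2 : ℝ) : ℂ)⁻¹) * ((Real.sqrt 2 : ℝ) : ℂ)⁻¹ = 1 / 2 := by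
      rw [← mul_inv, ← Complex.ofReal_mul, Real.mul_self_sqrt (by norm_num)]
      norm_num
    simp [Matrix.trace, Matrix.mul_apply, Fintype.sum_prod_type, bell, singlet, singletVec,
      Matrix.vecMulVec_apply]
    linear_combination (2 * (u + v) : ℂ) * hs

/-! ### Amplification of the fidelity -/

/-- The estimate behind the second round of postselection. The numbers `a`, `b`, `p`, `q` are the
entries of a Bell-diagonal operator, and the bit flip probability `p` is at most `t` times the
coherence `b`, which is what allows the phase flips to be suppressed before the bit flips become
likely again. -/
lemma exists_pow_fidelity {a b p q t δ : ℝ} (hb : 0 < b) (hba : b ≤ a) (hq : |q| ≤ p)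
    (ht : 0 < t) (ht' : t ≤ 1 / 2) (hpt : p ≤ t * b) (hδ : 0 < δ)
    (hδt : 4 * t * (2 / δ + 1) < δ) :
    ∃ m : ℕ, (1 - δ) * (2 * (a + b + p + q) ^ (m + 1) + 2 * (a - b + p - q) ^ (m + 1)) <
      (a + b + p + q) ^ (m + 1) + (a + b - p - q) ^ (m + 1) := by
  obtain ⟨hq1, hq2⟩ := abs_le.mp hq
  have hp : 0 ≤ p := (abs_nonneg q).trans hq
  have hpb : p ≤ b / 2 := hpt.trans (by nlinarith)
  set u := a + b + p + q with hu
  have hu0 : 0 < u := by linarith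
  set r := (a + b - p - q) / u with hr
  set s := (a - b + p - q) / u with hs
  set η := 2 * (b - p) / u with hη
  set K := 2 / δ with hK
  have hK0 : 0 < K := by positivity
  have hη0 : 0 < η := by
    apply div_pos _ hu0
    linarith
  have hs0 : 0 ≤ s := div_nonneg (by linarith) hu0.le
  have hr0 : 0 ≤ r := div_nonneg (by linarith) hu0.le
  have hs1 : s ≤ 1 - η := by
    rw [hs, hη, div_le_iff₀ hu0, sub_mul, div_mul_cancel₀ _ hu0.ne']
    linarith
  have hr1 : 1 - r ≤ 4 * p / u := by
    rw [hr, le_div_iff₀ hu0, sub_mul, div_mul_cancel₀ _ hu0.ne']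
    linarith
  obtain ⟨m, hm, hm'⟩ : ∃ m : ℕ, K ≤ (m + 1 : ℝ) * η ∧ (m : ℝ) * η ≤ K := by
    refine ⟨⌊K / η⌋₊, ?_, ?_⟩
    · exact ((div_lt_iff₀ hη0).mp (Nat.lt_floor_add_one (K / η))).le
    · exact (le_div_iff₀ hη0).mp (Nat.floor_le (by positivity))
  refine ⟨m, ?_⟩
  have e1 : a + b - p - q = r * u := by rw [hr, div_mul_cancel₀ _ hu0.ne']
  have e2 : a - b + p - q = s * u := by rw [hs, div_mul_cancel₀ _ hu0.ne']
  rw [e1, e2, mul_pow, mul_pow]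
  have hum : 0 < u ^ (m + 1) := by positivity
  have hη1 : η ≤ 1 := by linarith
  have hsm : s ^ (m + 1) ≤ δ / 2 := by
    have h1 : s ^ (m + 1) * (1 + (m + 1 : ℝ) * η) ≤ 1 := by
      have h2 : (1 + (m + 1 : ℝ) * η) ≤ (1 + η) ^ (m + 1) := by
        have := one_add_mul_le_pow (a := η) (by linarith) (m + 1)
        push_cast at this
        exact this
      calc s ^ (m + 1) * (1 + (m + 1 : ℝ) * η)
          ≤ (1 - η) ^ (m + 1) * (1 + η) ^ (m + 1) := by gcongr
        _ = (1 - η ^ 2) ^ (m + 1) := by rw [← mul_pow]; ring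
        _ ≤ 1 := pow_le_one₀ (by nlinarith) (by nlinarith)
    have h3 : s ^ (m + 1) * K ≤ 1 :=
      (mul_le_mul_of_nonneg_left (by linarith) (by positivity)).trans h1
    rw [hK, ← mul_div_assoc, div_le_one hδ] at h3
    linarith
  have hrm : 1 - δ < r ^ (m + 1) := by
    have h1 : 1 - (m + 1 : ℝ) * (1 - r) ≤ r ^ (m + 1) := by
      have := one_add_mul_le_pow (a := r - 1) (by linarith) (m + 1)
      push_cast at this
      rw [add_sub_cancel] at this
      linarith
    have h2 : (m : ℝ) * (4 * p / u) ≤ 4 * t * K := by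
      -- as `p ≤ t b` and `p ≤ b / 2`, one has `4 p / u ≤ 4 t η`
      have h3 : 4 * p / u ≤ 4 * t * η := by
        rw [hη, ← mul_div_assoc, div_le_div_iff_of_pos_right hu0]
        nlinarith
      calc (m : ℝ) * (4 * p / u) ≤ m * (4 * t * η) := by gcongr
        _ = 4 * t * (m * η) := by ring
        _ ≤ 4 * t * K := by gcongr
    have h4 : 4 * p / u ≤ 4 * t := by
      rw [div_le_iff₀ hu0]
      nlinarith
    have h5 : (m + 1 : ℝ) * (1 - r) ≤ (m + 1 : ℝ) * (4 * p / u) := by gcongr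
    linarith
  have hsm0 : 0 ≤ s ^ (m + 1) := by positivity
  have : (1 - δ) * (2 + 2 * s ^ (m + 1)) < 1 + r ^ (m + 1) := by
    have := mul_nonneg hδ.le hsm0
    linarith
  calc _ = (1 - δ) * (2 + 2 * s ^ (m + 1)) * u ^ (m + 1) := by ring
    _ < (1 + r ^ (m + 1)) * u ^ (m + 1) := by gcongr
    _ = _ := by ring

/-- From pairs in a Bell-diagonal state with fidelity above `1 / 2`, singlets of fidelity
arbitrarily close to `1` are reached: `n + 1` pairs are compared in the computational basis, and
`m + 1` of the resulting pairs in the complementary basis. -/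
lemma Reach.exists_singlet {A B : Type} [Fintype A] [Fintype B] {ρ : Matrix (A × B) (A × B) ℂ}
    {u v w z : ℝ} (h : Reach ρ (bell u v w z)) (hvu : v ≤ u) (hz : |z| ≤ w) (hwv : w < v)
    {δ : ℝ} (hδ : 0 < δ) :
    ∃ (Z : Matrix (Fin 2 × Fin 2) (Fin 2 × Fin 2) ℂ) (τ φ : ℝ), Reach ρ Z ∧ Z.trace = τ ∧
      (Z * singlet).trace = φ ∧ 0 < τ ∧ (1 - δ) * τ < φ := by
  have hw : 0 ≤ w := (abs_nonneg z).trans hz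
  have hv : 0 < v := hw.trans_lt hwv
  set t := min (1 / 2) (δ / (8 * (2 / δ + 1))) with ht
  have ht0 : 0 < t := by positivity
  have htδ : 4 * t * (2 / δ + 1) < δ := by
    have h1 : t ≤ δ / (8 * (2 / δ + 1)) := min_le_right _ _
    rw [le_div_iff₀ (by positivity)] at h1
    linarith
  obtain ⟨n, hn⟩ := exists_pow_lt_of_lt_one ht0 ((div_lt_one hv).mpr hwv)
  have hn' : w ^ (n + 1) ≤ t * v ^ (n + 1) := by
    have h1 : (w / v) ^ (n + 1) ≤ t :=
      (pow_le_pow_of_le_one (by positivity) ((div_lt_one hv).mpr hwv).le n.le_succ).trans hn.le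
    rwa [div_pow, div_le_iff₀ (by positivity)] at h1
  obtain ⟨m, hm⟩ := exists_pow_fidelity (a := u ^ (n + 1)) (b := v ^ (n + 1)) (p := w ^ (n + 1))
    (q := z ^ (n + 1)) (by positivity) (by gcongr) (by rw [abs_pow]; gcongr) ht0
    (min_le_left _ _) hn' hδ htδ
  have h1 := ((h.bell_pow n).trans (SepTo.hadamardGate _ _ _ _)).bell_pow m
  obtain ⟨Z, hZ, hZ1, hZ2⟩ := SepTo.bell_singlet _ _ _ _ |>.imp fun Z hZ => hZ.imp_left h1.trans
  refine ⟨Z, _, _, hZ, hZ1, hZ2, ?_, ?_⟩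
  · have h2 : |z ^ (n + 1)| ≤ w ^ (n + 1) := by rw [abs_pow]; gcongr
    have h3 : v ^ (n + 1) ≤ u ^ (n + 1) := by gcongr
    have h4 : 0 < v ^ (n + 1) := by positivity
    have h5 := abs_le.mp h2
    have h6 : 0 < 2 * (u ^ (n + 1) + v ^ (n + 1) + w ^ (n + 1) + z ^ (n + 1)) := by linarith
    have h7 : 0 ≤ 2 * (u ^ (n + 1) - v ^ (n + 1) + w ^ (n + 1) - z ^ (n + 1)) := by linarith
    positivity
  · simp only [mul_pow (2 : ℝ)]
    have h8 : (0 : ℝ) < 2 ^ (m + 1) := by positivity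
    linear_combination 2 ^ (m + 1) * hm

/-- Singlets of fidelity arbitrarily close to `1`, produced in parallel, are enough for
distillability. -/
lemma isDistillable_of_reach {A B : Type} [Fintype A] [DecidableEq A] [Fintype B] [DecidableEq B]
    {ρ : Matrix (A × B) (A × B) ℂ}
    (h : ∀ δ : ℝ, 0 < δ → ∃ (Z : Matrix (Fin 2 × Fin 2) (Fin 2 × Fin 2) ℂ) (τ φ : ℝ),
      Reach ρ Z ∧ Z.trace = τ ∧ (Z * singlet).trace = φ ∧ 0 < τ ∧ (1 - δ) * τ < φ) :
    IsDistillable ρ := by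
  intro k ε hε
  set δ := min 1 (ε / (k + 1)) with hδ
  have hδ0 : 0 < δ := by positivity
  have hδ1 : δ ≤ 1 := min_le_left _ _
  have hkδ : k * δ < ε := by
    have h1 : δ ≤ ε / (k + 1) := min_le_right _ _
    rw [le_div_iff₀ (by positivity)] at h1
    linarith
  obtain ⟨Z, τ, φ, hZ, hτ, hφ, hτ0, hlt⟩ := h δ hδ0
  obtain ⟨n, hn⟩ := hZ.copies k
  obtain ⟨Λ, c, hΛ, hc, hΛc⟩ := hn.exists_isLQCC
  have hc' : (c : ℂ) ≠ 0 := by exact_mod_cast hc.ne'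
  have hτ' : (τ : ℂ) ≠ 0 := by exact_mod_cast hτ0.ne'
  refine ⟨n, Λ, hΛ, ?_, ?_⟩
  · rw [hΛc, Matrix.trace_smul, trace_copies, hτ]
    exact mul_ne_zero hc' (pow_ne_zero _ hτ')
  · have h1 : singletFidelity k (normalized (Λ (copies n ρ))) = (φ / τ) ^ k := by
      rw [singletFidelity, normalized, hΛc, Matrix.trace_smul, trace_copies, hτ, smul_smul,
        Matrix.smul_mul, copies_mul, Matrix.trace_smul, trace_copies, hφ, smul_eq_mul, smul_eq_mul]
      have : ((c : ℂ) * τ ^ k)⁻¹ * c * φ ^ k = (((φ / τ) ^ k : ℝ) : ℂ) := by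
        push_cast
        rw [div_pow]
        field_simp
      rw [this, Complex.ofReal_re]
    rw [h1]
    have h2 : 1 - δ ≤ φ / τ := by
      rw [le_div_iff₀ hτ0]
      exact hlt.le
    have h3 := one_add_mul_le_pow (a := -δ) (by linarith) k
    calc 1 - ε < 1 + k * -δ := by linarith
      _ ≤ (1 + -δ) ^ k := h3
      _ ≤ (φ / τ) ^ k := by
        apply pow_le_pow_left₀ <;> linarith

/-- A reachable two-qubit operator whose fidelity with the maximally entangled vector
`(|00⟩ + |11⟩) / √2` exceeds `1 / 2` of its trace makes `ρ` distillable. -/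
lemma isDistillable_of_fidelity {A B : Type} [Fintype A] [DecidableEq A] [Fintype B]
    [DecidableEq B] {ρ : Matrix (A × B) (A × B) ℂ}
    {X : Matrix (Fin 2 × Fin 2) (Fin 2 × Fin 2) ℂ} (hρX : Reach ρ X) (hX : X.PosSemidef)
    (hlt : X.trace.re < (∑ a, ∑ b, X (a, a) (b, b)).re) : IsDistillable ρ := by
  have h := SepTo.twirl hX.isHermitian
  obtain ⟨hvu, hzw⟩ := bell_posSemidef (h.posSemidef hX)
  refine isDistillable_of_reach fun δ hδ => (hρX.trans h).exists_singlet hvu hzw ?_ hδ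
  have h1 : (X (1, 1) (0, 0)).re = (X (0, 0) (1, 1)).re := by
    rw [← hX.isHermitian.apply (1, 1) (0, 0)]
    simp
  simp only [Matrix.trace, Matrix.diag, Fintype.sum_prod_type, Fin.sum_univ_two, Complex.add_re]
    at hlt ⊢
  linarith

/-! ### Conjugate-linear symmetric maps -/

/-- If `T x = μ x` for `T ^ 2`, an eigenvector of `T` itself is `T x + √μ x`, or `i x` if that
vanishes. -/
lemma exists_antilinear_eigenvector {E : Type} [NormedAddCommGroup E] [InnerProductSpace ℂ E]
    [FiniteDimensional ℂ E] [Nontrivial E] (T : E →ₗ⋆[ℂ] E)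
    (hT : ∀ x y, inner ℂ (T x) y = inner ℂ (T y) x) :
    ∃ (v : E) (s : ℝ), ‖v‖ = 1 ∧ 0 ≤ s ∧ T v = (s : ℂ) • v := by
  suffices h : ∃ (v : E) (s : ℝ), v ≠ 0 ∧ 0 ≤ s ∧ T v = (s : ℂ) • v by
    obtain ⟨v, s, hv, hs, h⟩ := h
    refine ⟨((‖v‖⁻¹ : ℝ) : ℂ) • v, s, ?_, hs, ?_⟩
    · rw [norm_smul, Complex.norm_real, norm_inv, norm_norm,
        inv_mul_cancel₀ (norm_ne_zero_iff.mpr hv)]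
    · rw [map_smulₛₗ, h, Complex.conj_ofReal, smul_comm]
  obtain ⟨μ, hμ⟩ := Module.End.exists_eigenvalue (T.comp T : E →ₗ[ℂ] E)
  obtain ⟨x, hx⟩ := hμ.exists_hasEigenvector
  have hx0 : x ≠ 0 := hx.2
  have hTT : T (T x) = μ • x := hx.apply_eq_smul
  obtain ⟨s, hs, hμs⟩ : ∃ s : ℝ, 0 ≤ s ∧ μ = (s : ℂ) * s := by
    have h1 := hT (T x) x
    rw [hTT, inner_smul_left, inner_self_eq_norm_sq_to_K, inner_self_eq_norm_sq_to_K] at h1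
    have hn : (‖x‖ : ℂ) ≠ 0 := by exact_mod_cast norm_ne_zero_iff.mpr hx0
    have h2 : (starRingEnd ℂ) μ = ((‖T x‖ / ‖x‖ : ℝ) : ℂ) * (‖T x‖ / ‖x‖ : ℝ) := by
      have h1' : (starRingEnd ℂ) μ * (‖x‖ : ℂ) ^ 2 = (‖T x‖ : ℂ) ^ 2 := h1
      push_cast
      field_simp
      exact h1'
    refine ⟨‖T x‖ / ‖x‖, by positivity, ?_⟩
    rw [← Complex.conj_conj μ, h2, map_mul, Complex.conj_ofReal]
  by_cases hy : T x + (s : ℂ) • x = 0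
  · refine ⟨Complex.I • x, s, smul_ne_zero Complex.I_ne_zero hx0, hs, ?_⟩
    rw [map_smulₛₗ, eq_neg_of_add_eq_zero_left hy, Complex.conj_I, neg_smul_neg, smul_comm]
  · refine ⟨_, s, hy, hs, ?_⟩
    rw [map_add, map_smulₛₗ, hTT, Complex.conj_ofReal, smul_add, smul_smul, hμs, add_comm]

/-- A conjugate-linear symmetric map has an orthonormal basis of eigenvectors with nonnegative
eigenvalues; in terms of matrices this is Takagi's factorization of a complex symmetric matrix. -/
lemma exists_orthonormal_antilinear_eigenvectors (n : ℕ) :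
    ∀ (E : Type) [NormedAddCommGroup E] [InnerProductSpace ℂ E] [FiniteDimensional ℂ E],
      Module.finrank ℂ E = n → ∀ T : E →ₗ⋆[ℂ] E, (∀ x y, inner ℂ (T x) y = inner ℂ (T y) x) →
        ∃ (v : Fin n → E) (s : Fin n → ℝ), Orthonormal ℂ v ∧ ∀ i, 0 ≤ s i ∧
          T (v i) = (s i : ℂ) • v i := by
  induction n with
  | zero =>
    intro E _ _ _ _ T _
    exact ⟨Fin.elim0, Fin.elim0, ⟨fun i => i.elim0, fun i => i.elim0⟩, fun i => i.elim0⟩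
  | succ n ih =>
    intro E _ _ _ hn T hT
    have : Nontrivial E := Module.nontrivial_of_finrank_pos (R := ℂ) (by omega)
    obtain ⟨v, s, hv, hs, hvs⟩ := exists_antilinear_eigenvector T hT
    have hmem (x : (ℂ ∙ v)ᗮ) : T.domRestrict (ℂ ∙ v)ᗮ x ∈ (ℂ ∙ v)ᗮ := by
      rw [Submodule.mem_orthogonal_singleton_iff_inner_left, LinearMap.domRestrict_apply, hT, hvs,
        inner_smul_left, Submodule.mem_orthogonal_singleton_iff_inner_right.mp x.2, mul_zero]
    have hfr : Module.finrank ℂ (ℂ ∙ v)ᗮ = n := by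
      have : Fact (Module.finrank ℂ E = n + 1) := ⟨hn⟩
      exact Submodule.finrank_orthogonal_span_singleton (norm_ne_zero_iff.mp (by simp [hv]))
    obtain ⟨v', s', hv', hs'⟩ := ih (ℂ ∙ v)ᗮ hfr
      ((T.domRestrict (ℂ ∙ v)ᗮ).codRestrict (ℂ ∙ v)ᗮ hmem) fun x y => hT x y
    refine ⟨Fin.cons v fun i => v' i, Fin.cons s s', ?_, ?_⟩
    · rw [orthonormal_iff_ite] at hv' ⊢
      have h0 (i : Fin n) : inner ℂ v (v' i : E) = 0 :=
        Submodule.mem_orthogonal_singleton_iff_inner_right.mp (v' i).2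
      have h0' (i : Fin n) : inner ℂ (v' i : E) v = 0 :=
        Submodule.mem_orthogonal_singleton_iff_inner_left.mp (v' i).2
      intro i j
      refine Fin.cases ?_ (fun i => ?_) i <;> refine Fin.cases ?_ (fun j => ?_) j
      · simp [inner_self_eq_norm_sq_to_K, hv]
      · simp [h0, (Fin.succ_ne_zero j).symm]
      · simp [h0']
      · simpa using hv' i j
    · intro i
      refine Fin.cases ⟨hs, hvs⟩ (fun i => ⟨(hs' i).1, ?_⟩) i
      exact congrArg Subtype.val (hs' i).2

/-! ### Closed quadrilaterals -/

lemma exists_sum_eq_of_abs_sub_le {a b r : ℝ} (h1 : |a - b| ≤ r) (h2 : r ≤ a + b) :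
    ∃ w w' : ℂ, ‖w‖ = 1 ∧ ‖w'‖ = 1 ∧ a * w ^ 2 + b * w' ^ 2 = r := by
  have hcont : Continuous fun θ : ℝ => ‖(a : ℂ) + b * Complex.exp (θ * Complex.I)‖ := by fun_prop
  have hr : 0 ≤ r := (abs_nonneg _).trans h1
  obtain ⟨θ, -, hθ⟩ : r ∈ (fun θ : ℝ => ‖(a : ℂ) + b * Complex.exp (θ * Complex.I)‖) ''
      Set.Icc 0 Real.pi := by
    refine intermediate_value_Icc' Real.pi_pos.le hcont.continuousOn ⟨?_, ?_⟩
    · simp only [Complex.exp_pi_mul_I]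
      rw [mul_neg_one, ← sub_eq_add_neg, ← Complex.ofReal_sub, Complex.norm_real]
      exact h1
    · simp only [Complex.ofReal_zero, zero_mul, Complex.exp_zero, mul_one]
      rw [← Complex.ofReal_add, Complex.norm_real]
      exact h2.trans (le_abs_self _)
  set x : ℂ := (a : ℂ) + b * Complex.exp (θ * Complex.I) with hx
  have hθ' : ‖x‖ = r := hθ
  have hpol := Complex.norm_mul_exp_arg_mul_I x
  rw [hθ'] at hpol
  refine ⟨Complex.exp ((-x.arg / 2 : ℝ) * Complex.I),
    Complex.exp (((θ - x.arg) / 2 : ℝ) * Complex.I), Complex.norm_exp_ofReal_mul_I _,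
    Complex.norm_exp_ofReal_mul_I _, ?_⟩
  have e1 : Complex.exp ((-x.arg / 2 : ℝ) * Complex.I) ^ 2 =
      Complex.exp (-(x.arg * Complex.I)) := by
    rw [← Complex.exp_nat_mul]
    congr 1
    push_cast
    ring
  have e2 : Complex.exp (((θ - x.arg) / 2 : ℝ) * Complex.I) ^ 2 =
      Complex.exp (θ * Complex.I) * Complex.exp (-(x.arg * Complex.I)) := by
    rw [← Complex.exp_nat_mul, ← Complex.exp_add]
    congr 1
    push_cast
    ring
  rw [e1, e2]
  calc _ = x * Complex.exp (-(x.arg * Complex.I)) := by rw [hx]; ring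
    _ = r := by
      nth_rw 1 [← hpol]
      rw [mul_assoc, ← Complex.exp_add, add_neg_cancel, Complex.exp_zero, mul_one]

/-- Four lengths, none of which exceeds the sum of the others, are the sides of a closed
quadrilateral in the plane. -/
lemma exists_closed_quadrilateral {l : Fin 4 → ℝ} (hl : ∀ i, 0 ≤ l i)
    (h : ∀ i, 2 * l i ≤ ∑ j, l j) :
    ∃ w : Fin 4 → ℂ, (∀ i, ‖w i‖ = 1) ∧ ∑ i, (l i : ℂ) * w i ^ 2 = 0 := by
  simp only [Fin.sum_univ_four] at h ⊢
  set r := max |l 0 - l 1| |l 2 - l 3| with hr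
  have h0 := h 0
  have h1 := h 1
  have h2 := h 2
  have h3 := h 3
  have hl0 := hl 0
  have hl1 := hl 1
  have hl2 := hl 2
  have hl3 := hl 3
  obtain ⟨w0, w1, hw0, hw1, hw01⟩ := exists_sum_eq_of_abs_sub_le (a := l 0) (b := l 1) (r := r)
    (le_max_left _ _) (max_le (abs_le.mpr ⟨by linarith, by linarith⟩)
      (abs_le.mpr ⟨by linarith, by linarith⟩))
  obtain ⟨w2, w3, hw2, hw3, hw23⟩ := exists_sum_eq_of_abs_sub_le (a := l 2) (b := l 3) (r := r)
    (le_max_right _ _) (max_le (abs_le.mpr ⟨by linarith, by linarith⟩)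
      (abs_le.mpr ⟨by linarith, by linarith⟩))
  refine ⟨![w0, w1, Complex.I * w2, Complex.I * w3], ?_, ?_⟩
  · intro i
    fin_cases i <;> simp [hw0, hw1, hw2, hw3]
  · simp [mul_pow]
    linear_combination hw01 - hw23

/-! ### Two-qubit operators as families of `2 × 2` matrices -/

/-- The operator `∑ j, |m j⟩⟨m j|` on two qubits, where a matrix stands for the vector of its
entries. -/
def ofFamily (m : Fin 4 → Matrix (Fin 2) (Fin 2) ℂ) : Matrix (Fin 2 × Fin 2) (Fin 2 × Fin 2) ℂ :=
  Matrix.of fun x y => ∑ j, m j x.1 x.2 * star (m j y.1 y.2)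

/-- The polarization of twice the determinant. -/
def pdet (m n : Matrix (Fin 2) (Fin 2) ℂ) : ℂ :=
  m 0 0 * n 1 1 + m 1 1 * n 0 0 - m 0 1 * n 1 0 - m 1 0 * n 0 1

lemma pdet_self (m : Matrix (Fin 2) (Fin 2) ℂ) : pdet m m = 2 * m.det := by
  rw [pdet, Matrix.det_fin_two]
  ring

lemma pdet_comm (m n : Matrix (Fin 2) (Fin 2) ℂ) : pdet m n = pdet n m := by
  rw [pdet, pdet]
  ring

lemma pdet_mul_right (m n k : Matrix (Fin 2) (Fin 2) ℂ) :
    pdet (m * k) (n * k) = k.det * pdet m n := by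
  simp only [pdet, Matrix.det_fin_two, Matrix.mul_apply, Fin.sum_univ_two]
  ring

lemma pdet_smul_smul (c d : ℂ) (m n : Matrix (Fin 2) (Fin 2) ℂ) :
    pdet (c • m) (d • n) = c * d * pdet m n := by
  simp only [pdet, Matrix.smul_apply, smul_eq_mul]
  ring

lemma pdet_sum_sum {n : ℕ} (c d : Fin n → ℂ) (m m' : Fin n → Matrix (Fin 2) (Fin 2) ℂ) :
    pdet (∑ i, c i • m i) (∑ j, d j • m' j) = ∑ i, ∑ j, c i * d j * pdet (m i) (m' j) := by
  simp only [pdet, Matrix.sum_apply, Matrix.smul_apply, smul_eq_mul, Finset.sum_mul_sum,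
    ← Finset.sum_add_distrib, ← Finset.sum_sub_distrib]
  refine Finset.sum_congr rfl fun i _ => Finset.sum_congr rfl fun j _ => ?_
  ring

lemma exists_ofFamily {Z : Matrix (Fin 2 × Fin 2) (Fin 2 × Fin 2) ℂ} (hZ : Z.PosSemidef) :
    ∃ m, Z = ofFamily m := by
  obtain ⟨S, rfl⟩ := exists_eq_conjTranspose_mul_self hZ
  refine ⟨fun j => Matrix.of fun a b => star (S (finProdFinEquiv.symm j) (a, b)), ?_⟩
  ext x y
  simp only [Matrix.mul_apply, ofFamily, Matrix.of_apply, star_star, Matrix.conjTranspose_apply]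
  exact Fintype.sum_equiv (finProdFinEquiv (m := 2) (n := 2)) _ _ fun j => by simp

lemma prodConj_ofFamily (a b : Matrix (Fin 2) (Fin 2) ℂ) (m : Fin 4 → Matrix (Fin 2) (Fin 2) ℂ) :
    prodConj a bᵀ (ofFamily m) = ofFamily fun j => a * m j * b := by
  ext x y
  simp only [prodConj, ofFamily, Matrix.mul_apply, Matrix.of_apply, Matrix.conjTranspose_apply,
    Matrix.kroneckerMap_apply, Fintype.sum_prod_type, Fin.sum_univ_two, Fin.sum_univ_four,
    Matrix.transpose_apply, star_add, star_mul]
  ring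

/-- A unitary change of the family does not change the operator. -/
lemma ofFamily_unitary {U : Matrix (Fin 4) (Fin 4) ℂ} (hU : U * Uᴴ = 1)
    (m : Fin 4 → Matrix (Fin 2) (Fin 2) ℂ) :
    ofFamily (fun k => ∑ i, U i k • m i) = ofFamily m := by
  ext x y
  have h (i j : Fin 4) : ∑ k, U i k * star (U j k) = if i = j then 1 else 0 := by
    have := congrFun (congrFun hU i) j
    rwa [Matrix.mul_apply, Matrix.one_apply] at this
  simp only [ofFamily, Matrix.of_apply, Matrix.sum_apply, Matrix.smul_apply, smul_eq_mul, star_sum,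
    star_mul, Finset.sum_mul_sum]
  rw [Finset.sum_comm]
  refine Finset.sum_congr rfl fun i _ => ?_
  rw [Finset.sum_comm]
  calc _ = ∑ j, (∑ k, U i k * star (U j k)) * (m i x.1 x.2 * star (m j y.1 y.2)) := by
        refine Finset.sum_congr rfl fun j _ => ?_
        rw [Finset.sum_mul]
        refine Finset.sum_congr rfl fun k _ => ?_
        ring
    _ = _ := by
        simp only [h]
        simp

/-- Takagi's factorization makes the family orthogonal for the polarized determinant. -/
lemma exists_orthogonal_family (m : Fin 4 → Matrix (Fin 2) (Fin 2) ℂ) :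
    ∃ (m' : Fin 4 → Matrix (Fin 2) (Fin 2) ℂ) (s : Fin 4 → ℝ), ofFamily m' = ofFamily m ∧
      (∀ i, 0 ≤ s i) ∧ ∀ k l, pdet (m' k) (m' l) = if k = l then (s k : ℂ) else 0 := by
  let T : EuclideanSpace ℂ (Fin 4) →ₗ⋆[ℂ] EuclideanSpace ℂ (Fin 4) :=
    { toFun := fun x => WithLp.toLp 2 fun i => star (∑ j, pdet (m i) (m j) * x j)
      map_add' := fun x y => by
        ext i
        simp [mul_add, Finset.sum_add_distrib]
      map_smul' := fun c x => by
        ext i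
        simp [Finset.mul_sum, mul_left_comm] }
  have hTa (x : EuclideanSpace ℂ (Fin 4)) (i : Fin 4) :
      T x i = star (∑ j, pdet (m i) (m j) * x j) := rfl
  have hT (x y : EuclideanSpace ℂ (Fin 4)) : inner ℂ (T x) y = inner ℂ (T y) x := by
    simp only [PiLp.inner_apply, RCLike.inner_apply, hTa, starRingEnd_apply, star_star,
      Finset.mul_sum]
    rw [Finset.sum_comm]
    refine Finset.sum_congr rfl fun i _ => Finset.sum_congr rfl fun j _ => ?_
    rw [pdet_comm]
    ring
  obtain ⟨v, s, hv, hs⟩ := exists_orthonormal_antilinear_eigenvectors 4 _ (by simp) T hT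
  rw [orthonormal_iff_ite] at hv
  let U : Matrix (Fin 4) (Fin 4) ℂ := Matrix.of fun i k => v k i
  have hU : Uᴴ * U = 1 := by
    ext k l
    have := hv k l
    rw [PiLp.inner_apply] at this
    simp only [RCLike.inner_apply] at this
    rw [Matrix.mul_apply, Matrix.one_apply, ← this]
    refine Finset.sum_congr rfl fun i _ => ?_
    simp [U, mul_comm]
  refine ⟨fun k => ∑ i, U i k • m i, s, ofFamily_unitary (mul_eq_one_comm.mp hU) m,
    fun i => (hs i).1, fun k l => ?_⟩
  have hτ (i : Fin 4) : ∑ j, pdet (m i) (m j) * v l j = s l * star (v l i) := by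
    have := congrArg star (congrArg (fun x : EuclideanSpace ℂ (Fin 4) => x i) (hs l).2)
    simpa [hTa] using this
  rw [pdet_sum_sum]
  have h1 (i : Fin 4) : ∑ j, U i k * U j l * pdet (m i) (m j) = s l * (v k i * star (v l i)) := by
    rw [mul_left_comm, ← hτ, Finset.mul_sum]
    refine Finset.sum_congr rfl fun j _ => ?_
    simp only [U, Matrix.of_apply]
    ring
  simp only [h1, ← Finset.mul_sum]
  have h2 := hv l k
  rw [PiLp.inner_apply] at h2
  simp only [RCLike.inner_apply, starRingEnd_apply] at h2
  rw [h2]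
  by_cases hkl : k = l
  · simp [hkl]
  · simp [hkl, Ne.symm hkl]

/-- If the Takagi values of the family are the sides of a closed quadrilateral, then the family can
be chosen to consist of product vectors. -/
lemma exists_det_eq_zero_family {m : Fin 4 → Matrix (Fin 2) (Fin 2) ℂ} {s : Fin 4 → ℝ}
    (hs : ∀ i, 0 ≤ s i) (hm : ∀ k l, pdet (m k) (m l) = if k = l then (s k : ℂ) else 0)
    (h : ∀ i, 2 * s i ≤ ∑ j, s j) :
    ∃ m' : Fin 4 → Matrix (Fin 2) (Fin 2) ℂ, ofFamily m' = ofFamily m ∧ ∀ i, (m' i).det = 0 := by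
  obtain ⟨w, hw, hw0⟩ := exists_closed_quadrilateral hs h
  -- a Hadamard matrix: all its entries have the same modulus
  let H : Matrix (Fin 4) (Fin 4) ℂ :=
    !![1, 1, 1, 1; 1, -1, 1, -1; 1, 1, -1, -1; 1, -1, -1, 1]
  have hH : H * Hᴴ = (4 : ℂ) • 1 := by
    ext i j
    fin_cases i <;> fin_cases j <;>
      simp [H, Matrix.mul_apply, Fin.sum_univ_four, Matrix.conjTranspose_apply] <;> norm_num
  have hH2 (i j : Fin 4) : H i j ^ 2 = 1 := by
    fin_cases i <;> fin_cases j <;> simp [H]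
  let U : Matrix (Fin 4) (Fin 4) ℂ := (1 / 2 : ℂ) • (Matrix.diagonal w * H)
  have hD : Matrix.diagonal w * (Matrix.diagonal w)ᴴ = 1 := by
    rw [Matrix.diagonal_conjTranspose, Matrix.diagonal_mul_diagonal, ← Matrix.diagonal_one]
    congr 1
    ext i
    have := Complex.mul_conj' (w i)
    rw [hw i] at this
    simpa using this
  have hU : U * Uᴴ = 1 := by
    simp only [U, Matrix.conjTranspose_smul, Matrix.smul_mul, Matrix.mul_smul, smul_smul,
      Matrix.conjTranspose_mul]
    rw [Matrix.mul_assoc, ← Matrix.mul_assoc H, hH, Matrix.smul_mul, Matrix.mul_smul, smul_smul,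
      Matrix.one_mul, hD]
    norm_num
  refine ⟨fun k => ∑ i, U i k • m i, ofFamily_unitary hU m, fun k => ?_⟩
  have h2 : 2 * (∑ i, U i k • m i).det = 0 := by
    rw [← pdet_self, pdet_sum_sum]
    have h3 (i : Fin 4) : ∑ j, U i k * U j k * pdet (m i) (m j) = 1 / 4 * (s i * w i ^ 2) := by
      simp only [hm]
      simp only [mul_ite, mul_zero, Finset.sum_ite_eq, Finset.mem_univ, if_true, U,
        Matrix.smul_apply, smul_eq_mul, Matrix.diagonal_mul]
      linear_combination (1 / 4 * w i ^ 2 * s i) * hH2 i k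
    simp only [h3, ← Finset.mul_sum, hw0, mul_zero]
  simpa using h2

/-! ### Quaternion units and local filters -/

lemma mul_self_of_trace_eq_zero {x : Matrix (Fin 2) (Fin 2) ℂ} (hx : x.trace = 0)
    (hx1 : x.det = 1) : x * x = -1 := by
  rw [Matrix.trace_fin_two] at hx
  rw [Matrix.det_fin_two] at hx1
  ext i j
  fin_cases i <;> fin_cases j <;> simp [Matrix.mul_apply, Fin.sum_univ_two]
  · linear_combination x 0 0 * hx - hx1
  · linear_combination x 0 1 * hx
  · linear_combination x 1 0 * hx
  · linear_combination x 1 1 * hx - hx1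

lemma mul_eq_neg_mul_of_pdet {x y : Matrix (Fin 2) (Fin 2) ℂ} (hx : x.trace = 0)
    (hy : y.trace = 0) (hxy : pdet x y = 0) : x * y = -(y * x) := by
  rw [Matrix.trace_fin_two] at hx hy
  rw [pdet] at hxy
  ext i j
  fin_cases i <;> fin_cases j <;> simp [Matrix.mul_apply, Fin.sum_univ_two]
  · linear_combination y 0 0 * hx + x 0 0 * hy - hxy
  · linear_combination y 0 1 * hx + x 0 1 * hy
  · linear_combination y 1 0 * hx + x 1 0 * hy
  · linear_combination y 1 1 * hx + x 1 1 * hy - hxy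

lemma exists_eq_smul_of_commute {w z : Matrix (Fin 2) (Fin 2) ℂ} (hw : w.trace = 0)
    (hw1 : w.det = 1) (hz : z.trace = 0) (hwz : w * z = z * w) : ∃ κ : ℂ, z = κ • w := by
  have hw' : w 1 1 = -w 0 0 := by
    rw [Matrix.trace_fin_two] at hw
    linear_combination hw
  have hz' : z 1 1 = -z 0 0 := by
    rw [Matrix.trace_fin_two] at hz
    linear_combination hz
  rw [Matrix.det_fin_two, hw'] at hw1
  have h00 := congrFun (congrFun hwz 0) 0
  have h01 := congrFun (congrFun hwz 0) 1
  have h10 := congrFun (congrFun hwz 1) 0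
  simp only [Matrix.mul_apply, Fin.sum_univ_two, hw', hz'] at h00 h01 h10
  refine ⟨-(w * z).trace / 2, ?_⟩
  ext i j
  fin_cases i <;> fin_cases j <;>
    simp [Matrix.trace_fin_two, Matrix.mul_apply, Fin.sum_univ_two, hw', hz']
  · linear_combination (-z 0 0) * hw1 - w 0 1 / 4 * h10 + w 1 0 / 4 * h01
  · linear_combination (-z 0 1) * hw1 - w 0 0 / 2 * h01 + w 0 1 / 2 * h00
  · linear_combination (-z 1 0) * hw1 + w 0 0 / 2 * h10 - w 1 0 / 2 * h00
  · linear_combination (-z 0 0) * hw1 - w 0 1 / 4 * h10 + w 1 0 / 4 * h01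

/-- Three traceless matrices of determinant `1` that are pairwise orthogonal for the polarized
determinant generate, up to sign, the quaternion group of order eight. Averaging the standard
form over that group gives a positive definite form that they leave invariant. -/
lemma exists_invariant_form {x y z : Matrix (Fin 2) (Fin 2) ℂ} (hx : x.trace = 0)
    (hy : y.trace = 0) (hz : z.trace = 0) (hx1 : x.det = 1) (hy1 : y.det = 1) (hz1 : z.det = 1)
    (hxy : pdet x y = 0) (hxz : pdet x z = 0) (hyz : pdet y z = 0) :
    ∃ h : Matrix (Fin 2) (Fin 2) ℂ, h.PosDef ∧ xᴴ * h * x = h ∧ yᴴ * h * y = h ∧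
      zᴴ * h * z = h := by
  have hxx := mul_self_of_trace_eq_zero hx hx1
  have hyy := mul_self_of_trace_eq_zero hy hy1
  have axy := mul_eq_neg_mul_of_pdet hx hy hxy
  have axz := mul_eq_neg_mul_of_pdet hx hz hxz
  have ayz := mul_eq_neg_mul_of_pdet hy hz hyz
  have htr : (x * y).trace = 0 := by
    have h1 := congrArg Matrix.trace axy
    rw [Matrix.trace_neg, Matrix.trace_mul_comm y x] at h1
    linear_combination h1 / 2
  have hdet : (x * y).det = 1 := by rw [Matrix.det_mul, hx1, hy1, one_mul]
  have hcomm : (x * y) * z = z * (x * y) := by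
    rw [Matrix.mul_assoc, ayz, Matrix.mul_neg, ← Matrix.mul_assoc, axz, Matrix.neg_mul, neg_neg,
      Matrix.mul_assoc]
  obtain ⟨κ, rfl⟩ := exists_eq_smul_of_commute htr hdet hz hcomm
  have hκ : star κ * κ = 1 := by
    rw [Matrix.det_smul, hdet, Fintype.card_fin, mul_one, sq] at hz1
    rcases mul_self_eq_one_iff.mp hz1 with h | h <;> simp [h]
  set h : Matrix (Fin 2) (Fin 2) ℂ := 1 + xᴴ * x + yᴴ * y + (x * y)ᴴ * (x * y) with hh
  have hpd : h.PosDef := ((Matrix.PosDef.one.add_posSemidef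
    (Matrix.posSemidef_conjTranspose_mul_self _)).add_posSemidef
    (Matrix.posSemidef_conjTranspose_mul_self _)).add_posSemidef
    (Matrix.posSemidef_conjTranspose_mul_self _)
  have hform (u : Matrix (Fin 2) (Fin 2) ℂ) : uᴴ * h * u =
      uᴴ * u + (x * u)ᴴ * (x * u) + (y * u)ᴴ * (y * u) + (x * y * u)ᴴ * (x * y * u) := by
    simp only [hh, Matrix.conjTranspose_mul, Matrix.mul_add, Matrix.add_mul, Matrix.mul_assoc,
      Matrix.mul_one]
  have hhx : xᴴ * h * x = h := by
    have e1 : y * x = -(x * y) := by rw [axy, neg_neg]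
    have e2 : x * y * x = y := by
      rw [Matrix.mul_assoc, e1, Matrix.mul_neg, ← Matrix.mul_assoc, hxx, Matrix.neg_mul, neg_neg,
        Matrix.one_mul]
    rw [hform, hxx, e1, e2, hh]
    simp only [Matrix.conjTranspose_neg, neg_mul_neg, Matrix.conjTranspose_one, Matrix.mul_one]
    abel
  have hhy : yᴴ * h * y = h := by
    have e2 : x * y * y = -x := by rw [Matrix.mul_assoc, hyy, Matrix.mul_neg, Matrix.mul_one]
    rw [hform, hyy, e2, hh]
    simp only [Matrix.conjTranspose_neg, neg_mul_neg, Matrix.conjTranspose_one, Matrix.mul_one]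
    abel
  refine ⟨h, hpd, hhx, hhy, ?_⟩
  rw [Matrix.conjTranspose_smul, Matrix.smul_mul, Matrix.smul_mul, Matrix.mul_smul, smul_smul, hκ,
    one_smul, Matrix.conjTranspose_mul]
  calc yᴴ * xᴴ * h * (x * y) = yᴴ * (xᴴ * h * x) * y := by simp only [Matrix.mul_assoc]
    _ = h := by rw [hhx, hhy]

/-- The trace of an operator on two qubits minus twice its expectation in the maximally entangled
vector `(|00⟩ + |11⟩) / √2`. -/
def entGap (X : Matrix (Fin 2 × Fin 2) (Fin 2 × Fin 2) ℂ) : ℝ :=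
  (X.trace - ∑ a, ∑ b, X (a, a) (b, b)).re

lemma entGap_sum {X : Type} [Fintype X] (r : X → ℝ)
    (M : X → Matrix (Fin 2 × Fin 2) (Fin 2 × Fin 2) ℂ) :
    entGap (∑ x, (r x : ℂ) • M x) = ∑ x, r x * entGap (M x) := by
  simp only [entGap, ← Complex.re_ofReal_mul, ← Complex.re_sum, Matrix.trace_sum,
    Matrix.trace_smul, Matrix.sum_apply, Matrix.smul_apply, smul_eq_mul]
  congr 1
  simp only [Fin.sum_univ_two, ← Finset.sum_add_distrib, ← Finset.sum_sub_distrib]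
  refine Finset.sum_congr rfl fun x _ => ?_
  ring

lemma entGap_ofFamily (m : Fin 4 → Matrix (Fin 2) (Fin 2) ℂ) :
    entGap (ofFamily m) = ∑ j, (((m j)ᴴ * m j).trace.re - ‖(m j).trace‖ ^ 2) := by
  have h : (ofFamily m).trace - ∑ a, ∑ b, ofFamily m (a, a) (b, b) =
      ∑ j, (((m j)ᴴ * m j).trace - (m j).trace * star (m j).trace) := by
    simp only [ofFamily, Matrix.trace, Matrix.diag, Matrix.of_apply, Fintype.sum_prod_type,
      Matrix.mul_apply, Fin.sum_univ_two, Fin.sum_univ_four, Matrix.conjTranspose_apply, star_add]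
    ring
  rw [entGap, h, Complex.re_sum]
  refine Finset.sum_congr rfl fun j _ => ?_
  rw [Complex.sub_re]
  congr 1
  have := Complex.mul_conj' (m j).trace
  rw [← starRingEnd_apply, this]
  norm_cast

/-- If one Takagi value exceeds the sum of the others, a local filter raises the fidelity above
`1 / 2`. Bob's operation turns the corresponding vector into a maximally entangled one; the other
vectors then are multiples of quaternion units, and the change of basis that makes these unitary
minimizes their lengths. -/
lemma exists_filter_of_lt {m : Fin 4 → Matrix (Fin 2) (Fin 2) ℂ} {s : Fin 4 → ℝ}
    (hs : ∀ i, 0 < s i) (hm : ∀ k l, pdet (m k) (m l) = if k = l then (s k : ℂ) else 0)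
    (h : s 1 + s 2 + s 3 < s 0) :
    ∃ a b : Matrix (Fin 2) (Fin 2) ℂ, entGap (prodConj a b (ofFamily m)) < 0 := by
  have hs0 : (s 0 : ℂ) ≠ 0 := by exact_mod_cast (hs 0).ne'
  have hdet : (m 0).det = s 0 / 2 := by
    have := hm 0 0
    rw [pdet_self, if_pos rfl] at this
    linear_combination this / 2
  have hdet0 : IsUnit (m 0).det := by
    rw [hdet]
    exact (div_ne_zero hs0 two_ne_zero).isUnit
  set M := (m 0)⁻¹ with hM
  have hMdet : M.det = 2 / s 0 := by
    rw [hM, Matrix.det_nonsing_inv, hdet, Ring.inverse_eq_inv', inv_div]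
  have hmM : m 0 * M = 1 := Matrix.mul_nonsing_inv _ hdet0
  -- the vectors `m j * M`, normalized to determinant one
  let c : Fin 4 → ℝ := fun j => Real.sqrt (s 0 / s j)
  have hcc (j : Fin 4) : (c j : ℂ) * c j * s j = s 0 := by
    have : c j * c j * s j = s 0 := by
      rw [Real.mul_self_sqrt (div_nonneg (hs 0).le (hs j).le), div_mul_cancel₀ _ (hs j).ne']
    exact_mod_cast this
  let q : Fin 4 → Matrix (Fin 2) (Fin 2) ℂ := fun j => (c j : ℂ) • (m j * M)
  have hq (k l : Fin 4) : pdet (q k) (q l) = if k = l then 2 else 0 := by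
    rw [pdet_smul_smul, pdet_mul_right, hm, hMdet]
    split_ifs with hkl
    · subst hkl
      rw [mul_left_comm, hcc]
      field_simp
    · simp
  have hqdet (j : Fin 4) : (q j).det = 1 := by
    have := hq j j
    rw [pdet_self, if_pos rfl] at this
    linear_combination this / 2
  have hqtr (j : Fin 4) (hj : j ≠ 0) : (q j).trace = 0 := by
    have h0 : q 0 = 1 := by
      simp only [q, c, hmM, div_self (hs 0).ne', Real.sqrt_one, Complex.ofReal_one, one_smul]
    have := hq j 0
    rw [h0, if_neg hj, pdet] at this
    rw [Matrix.trace_fin_two]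
    simpa [add_comm] using this
  obtain ⟨f, hf, h1, h2, h3⟩ := exists_invariant_form (hqtr 1 (by decide)) (hqtr 2 (by decide))
    (hqtr 3 (by decide)) (hqdet 1) (hqdet 2) (hqdet 3)
    (by rw [hq, if_neg (by decide)]) (by rw [hq, if_neg (by decide)])
    (by rw [hq, if_neg (by decide)])
  obtain ⟨g, rfl⟩ := exists_eq_conjTranspose_mul_self hf.posSemidef
  have hg : IsUnit g.det := by
    have := (Matrix.isUnit_iff_isUnit_det _).mp hf.isUnit
    rw [Matrix.det_mul] at this
    exact isUnit_of_mul_isUnit_right this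
  have hgg : g * g⁻¹ = 1 := Matrix.mul_nonsing_inv _ hg
  have hgg' : (g⁻¹)ᴴ * gᴴ = 1 := by rw [← Matrix.conjTranspose_mul, hgg, Matrix.conjTranspose_one]
  have hunit (x : Matrix (Fin 2) (Fin 2) ℂ) (hx : xᴴ * (gᴴ * g) * x = gᴴ * g) :
      (g * x * g⁻¹)ᴴ * (g * x * g⁻¹) = 1 := by
    calc (g * x * g⁻¹)ᴴ * (g * x * g⁻¹) = (g⁻¹)ᴴ * (xᴴ * (gᴴ * g) * x) * g⁻¹ := by
          simp only [Matrix.conjTranspose_mul, Matrix.mul_assoc]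
      _ = (g⁻¹)ᴴ * gᴴ * (g * g⁻¹) := by rw [hx]; simp only [Matrix.mul_assoc]
      _ = 1 := by rw [hgg, hgg', Matrix.one_mul]
  refine ⟨g, (M * g⁻¹)ᵀ, ?_⟩
  rw [prodConj_ofFamily, entGap_ofFamily]
  have hterm (j : Fin 4) (hj : ((q j)ᴴ * (gᴴ * g) * q j = gᴴ * g)) :
      (((g * m j * (M * g⁻¹))ᴴ * (g * m j * (M * g⁻¹))).trace.re
        - ‖(g * m j * (M * g⁻¹)).trace‖ ^ 2) ≤ 2 * (s j / s 0) := by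
    have hc : (c j : ℂ) ≠ 0 := by
      have : 0 < c j := Real.sqrt_pos.mpr (div_pos (hs 0) (hs j))
      exact_mod_cast this.ne'
    have e1 : g * m j * (M * g⁻¹) = (c j : ℂ)⁻¹ • (g * q j * g⁻¹) := by
      simp only [q, Matrix.mul_smul, Matrix.smul_mul, smul_smul, inv_mul_cancel₀ hc, one_smul,
        Matrix.mul_assoc]
    rw [e1, Matrix.conjTranspose_smul, Matrix.smul_mul, Matrix.mul_smul, smul_smul, hunit _ hj,
      Matrix.trace_smul, Matrix.trace_one]
    have e2 : star (c j : ℂ)⁻¹ * (c j : ℂ)⁻¹ = ((s j / s 0 : ℝ) : ℂ) := by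
      have : (star (c j : ℂ)) = c j := Complex.conj_ofReal _
      rw [star_inv₀, this]
      push_cast
      rw [← hcc j]
      have : (s j : ℂ) ≠ 0 := by exact_mod_cast (hs j).ne'
      field_simp
    rw [e2, smul_eq_mul, Fintype.card_fin, Complex.re_ofReal_mul]
    have := sq_nonneg ‖((c j : ℂ)⁻¹ • (g * q j * g⁻¹)).trace‖
    simp only [Nat.cast_ofNat, Complex.re_ofNat]
    linarith
  have hzero : (((g * m 0 * (M * g⁻¹))ᴴ * (g * m 0 * (M * g⁻¹))).trace.re
        - ‖(g * m 0 * (M * g⁻¹)).trace‖ ^ 2) = -2 := by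
    have e1 : g * m 0 * (M * g⁻¹) = 1 := by
      rw [Matrix.mul_assoc, ← Matrix.mul_assoc (m 0), hmM, Matrix.one_mul, hgg]
    rw [e1]
    norm_num
  rw [Fin.sum_univ_four, hzero]
  have t1 := hterm 1 h1
  have t2 := hterm 2 h2
  have t3 := hterm 3 h3
  have t4 : s 1 / s 0 + s 2 / s 0 + s 3 / s 0 < 1 := by
    rw [← add_div, ← add_div, div_lt_one (hs 0)]
    exact h
  linarith

/-! ### Two-qubit operators: separability or a filter -/

lemma takagi_values_pos {m : Fin 4 → Matrix (Fin 2) (Fin 2) ℂ} {s : Fin 4 → ℝ}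
    (hs : ∀ i, 0 ≤ s i) (hm : ∀ k l, pdet (m k) (m l) = if k = l then (s k : ℂ) else 0)
    (hpd : (ofFamily m).PosDef) (i : Fin 4) : 0 < s i := by
  let f : Fin 4 → Fin 2 × Fin 2 := ![(0, 0), (0, 1), (1, 0), (1, 1)]
  have hf : Function.Injective f := by decide
  let V : Matrix (Fin 4) (Fin 4) ℂ := Matrix.of fun x j => m j (f x).1 (f x).2
  have hV : V.det ≠ 0 := by
    have h1 : (ofFamily m).submatrix f f = V * Vᴴ := by
      ext x y
      simp [ofFamily, V, Matrix.mul_apply]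
    have h2 := (hpd.submatrix hf).det_pos
    rw [h1, Matrix.det_mul] at h2
    exact left_ne_zero_of_mul h2.ne'
  -- the Gram matrix of the polarized determinant
  let G : Matrix (Fin 4) (Fin 4) ℂ := !![0, 0, 0, 1; 0, 0, -1, 0; 0, -1, 0, 0; 1, 0, 0, 0]
  have hG : G * G = 1 := by
    ext i j
    fin_cases i <;> fin_cases j <;> simp [G, Matrix.mul_apply, Fin.sum_univ_four]
  have hG' : G.det ≠ 0 := by
    have := congrArg Matrix.det hG
    rw [Matrix.det_mul, Matrix.det_one] at this
    exact left_ne_zero_of_mul_eq_one this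
  have h1 : Vᵀ * G * V = Matrix.diagonal fun i => (s i : ℂ) := by
    ext k l
    rw [Matrix.diagonal_apply, ← hm k l]
    simp [Matrix.mul_apply, Fin.sum_univ_four, G, V, f, pdet]
    ring
  have h2 : ∏ i, (s i : ℂ) ≠ 0 := by
    rw [← Matrix.det_diagonal, ← h1, Matrix.det_mul, Matrix.det_mul, Matrix.det_transpose]
    exact mul_ne_zero (mul_ne_zero hV hG') hV
  have h3 : (s i : ℂ) ≠ 0 := Finset.prod_ne_zero_iff.mp h2 i (Finset.mem_univ i)
  exact (hs i).lt_of_ne' (by exact_mod_cast h3)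

lemma ofFamily_comp_perm (σ : Equiv.Perm (Fin 4)) (m : Fin 4 → Matrix (Fin 2) (Fin 2) ℂ) :
    ofFamily (m ∘ σ) = ofFamily m := by
  ext x y
  exact Equiv.sum_comp σ fun j => m j x.1 x.2 * star (m j y.1 y.2)

lemma exists_family_or_filter_of_posDef {Z : Matrix (Fin 2 × Fin 2) (Fin 2 × Fin 2) ℂ}
    (hZ : Z.PosDef) :
    (∃ m, Z = ofFamily m ∧ ∀ i, (m i).det = 0) ∨ ∃ a b, entGap (prodConj a b Z) < 0 := by
  obtain ⟨m₀, rfl⟩ := exists_ofFamily hZ.posSemidef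
  obtain ⟨m, s, hmm, hs, hm⟩ := exists_orthogonal_family m₀
  rw [← hmm] at hZ ⊢
  have hs' := takagi_values_pos hs hm hZ
  by_cases h : ∀ i, 2 * s i ≤ ∑ j, s j
  · obtain ⟨m', hm', hdet⟩ := exists_det_eq_zero_family hs hm h
    exact Or.inl ⟨m', hm'.symm, hdet⟩
  · push Not at h
    obtain ⟨i, hi⟩ := h
    right
    rw [← ofFamily_comp_perm (Equiv.swap 0 i)]
    refine exists_filter_of_lt (s := s ∘ Equiv.swap 0 i) (fun j => hs' _) (fun k l => ?_) ?_
    · simp [hm]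
    · have h1 := Equiv.sum_comp (Equiv.swap 0 i) s
      rw [Fin.sum_univ_four] at h1
      rw [← h1, Equiv.swap_apply_left] at hi
      simp only [Function.comp_apply, Equiv.swap_apply_left]
      linarith

/-- Sums of four product vectors form a closed set. -/
lemma exists_family_of_forall_add_smul_one {Z : Matrix (Fin 2 × Fin 2) (Fin 2 × Fin 2) ℂ}
    (h : ∀ n : ℕ, ∃ m, Z + ((1 / (n + 1 : ℝ) : ℝ) : ℂ) • 1 = ofFamily m ∧ ∀ i, (m i).det = 0) :
    ∃ m, Z = ofFamily m ∧ ∀ i, (m i).det = 0 := by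
  choose m hm hdet using h
  let F : ℕ → Fin 4 → Fin 2 → Fin 2 → ℂ := m
  set R : ℝ := ∑ x, ‖Z x x‖ + 2 with hR
  have hS : 0 ≤ ∑ x, ‖Z x x‖ := Finset.sum_nonneg fun _ _ => norm_nonneg _
  have hbound (n : ℕ) (j : Fin 4) (a b : Fin 2) : ‖F n j a b‖ ≤ R := by
    have h1 := congrFun (congrFun (hm n) (a, b)) (a, b)
    have h2 : ofFamily (m n) (a, b) (a, b) = ((∑ j, ‖F n j a b‖ ^ 2 : ℝ) : ℂ) := by
      simp only [ofFamily, Matrix.of_apply, ← starRingEnd_apply, Complex.mul_conj']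
      push_cast
      rfl
    rw [h2] at h1
    have h3 : ∑ j, ‖F n j a b‖ ^ 2 ≤ ∑ x, ‖Z x x‖ + 1 := by
      calc ∑ j, ‖F n j a b‖ ^ 2 ≤ ‖((∑ j, ‖F n j a b‖ ^ 2 : ℝ) : ℂ)‖ := by
            rw [Complex.norm_real]
            exact le_abs_self _
        _ = ‖(Z + ((1 / (n + 1 : ℝ) : ℝ) : ℂ) • 1) (a, b) (a, b)‖ := by rw [h1]
        _ ≤ ‖Z (a, b) (a, b)‖ + ‖((1 / (n + 1 : ℝ) : ℝ) : ℂ)‖ := by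
            rw [Matrix.add_apply, Matrix.smul_apply, Matrix.one_apply_eq, smul_eq_mul, mul_one]
            exact norm_add_le _ _
        _ ≤ ∑ x, ‖Z x x‖ + 1 := by
            gcongr
            · exact Finset.single_le_sum (f := fun x => ‖Z x x‖) (fun _ _ => norm_nonneg _)
                (Finset.mem_univ (a, b))
            · rw [Complex.norm_real, Real.norm_of_nonneg (by positivity)]
              rw [div_le_one (by positivity)]
              linarith [(Nat.cast_nonneg n : (0 : ℝ) ≤ n)]
    have h4 : ‖F n j a b‖ ^ 2 ≤ ∑ j, ‖F n j a b‖ ^ 2 :=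
      Finset.single_le_sum (f := fun j => ‖F n j a b‖ ^ 2) (fun _ _ => sq_nonneg _)
        (Finset.mem_univ j)
    nlinarith [sq_nonneg (‖F n j a b‖ - 1)]
  have hball (n : ℕ) : F n ∈ Metric.closedBall (0 : Fin 4 → Fin 2 → Fin 2 → ℂ) R := by
    rw [mem_closedBall_zero_iff]
    have hR0 : 0 ≤ R := by linarith
    exact (pi_norm_le_iff_of_nonneg hR0).mpr fun j => (pi_norm_le_iff_of_nonneg hR0).mpr fun a =>
      (pi_norm_le_iff_of_nonneg hR0).mpr fun b => hbound n j a b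
  obtain ⟨L, -, φ, hφ, hL⟩ := (isCompact_closedBall _ _).tendsto_subseq hball
  have hlim (j : Fin 4) (a b : Fin 2) :
      Filter.Tendsto (fun n => m (φ n) j a b) Filter.atTop (nhds (L j a b)) :=
    tendsto_pi_nhds.mp (tendsto_pi_nhds.mp (tendsto_pi_nhds.mp hL j) a) b
  refine ⟨fun j => Matrix.of (L j), ?_, fun j => ?_⟩
  · ext x y
    have h1 : Filter.Tendsto (fun n => ofFamily (m (φ n)) x y) Filter.atTop
        (nhds (ofFamily (fun j => Matrix.of (L j)) x y)) := by
      simp only [ofFamily, Matrix.of_apply]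
      exact tendsto_finsetSum _ fun j _ => (hlim j _ _).mul (hlim j _ _).star
    have h2 : Filter.Tendsto (fun n => ofFamily (m (φ n)) x y) Filter.atTop (nhds (Z x y)) := by
      have h3 : Filter.Tendsto (fun n : ℕ => Z x y + ((1 / (φ n + 1 : ℝ) : ℝ) : ℂ) *
          (1 : Matrix (Fin 2 × Fin 2) (Fin 2 × Fin 2) ℂ) x y) Filter.atTop
          (nhds (Z x y + ((0 : ℝ) : ℂ) * (1 : Matrix (Fin 2 × Fin 2) (Fin 2 × Fin 2) ℂ) x y)) := by
        refine tendsto_const_nhds.add (Filter.Tendsto.mul_const _ ?_)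
        exact (Complex.continuous_ofReal.tendsto _).comp
          (tendsto_one_div_add_atTop_nhds_zero_nat.comp hφ.tendsto_atTop)
      rw [Complex.ofReal_zero, zero_mul, add_zero] at h3
      refine h3.congr fun n => ?_
      rw [← hm]
      rfl
    exact tendsto_nhds_unique h2 h1
  · have h1 : Filter.Tendsto (fun n => (m (φ n) j).det) Filter.atTop
        (nhds (Matrix.of (L j)).det) := by
      simp only [Matrix.det_fin_two, Matrix.of_apply]
      exact ((hlim j _ _).mul (hlim j _ _)).sub ((hlim j _ _).mul (hlim j _ _))
    simp only [hdet] at h1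
    exact tendsto_nhds_unique h1 tendsto_const_nhds

lemma trace_mul_nonneg_of_posSemidef {I : Type} [Fintype I] [DecidableEq I] {S T : Matrix I I ℂ}
    (hS : S.PosSemidef) (hT : T.PosSemidef) : 0 ≤ (S * T).trace := by
  obtain ⟨B, rfl⟩ := exists_eq_conjTranspose_mul_self hS
  rw [Matrix.mul_assoc, Matrix.trace_mul_comm]
  exact (hT.mul_mul_conjTranspose_same B).trace_nonneg

/-- Product operators have fidelity at most `1 / 2` with a maximally entangled vector. -/
lemma entGap_kronecker_nonneg {S T : Matrix (Fin 2) (Fin 2) ℂ} (hS : S.PosSemidef)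
    (hT : T.PosSemidef) : 0 ≤ entGap (S ⊗ₖ T) := by
  let y : Matrix (Fin 2) (Fin 2) ℂ := !![0, 1; -1, 0]
  have h := trace_mul_nonneg_of_posSemidef hS (hT.mul_mul_conjTranspose_same y)
  have e : (S * (y * T * yᴴ)).trace = (S ⊗ₖ T).trace - ∑ a, ∑ b, (S ⊗ₖ T) (a, a) (b, b) := by
    have hy : y * T * yᴴ = !![T 1 1, -T 1 0; -T 0 1, T 0 0] := by
      ext i j
      fin_cases i <;> fin_cases j <;> simp [y, Matrix.mul_apply, Fin.sum_univ_two, Matrix.vecMul,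
        dotProduct]
    rw [hy]
    simp [Matrix.trace, Fintype.sum_prod_type, Matrix.mul_apply, Fin.sum_univ_two]
    ring
  rw [e] at h
  exact (Complex.nonneg_iff.mp h).1

/-- A positive semidefinite operator on two qubits is a sum of product operators, or else a local
filter raises its fidelity with a maximally entangled vector above `1 / 2`. -/
lemma exists_family_or_filter {Z : Matrix (Fin 2 × Fin 2) (Fin 2 × Fin 2) ℂ}
    (hZ : Z.PosSemidef) :
    (∃ m, Z = ofFamily m ∧ ∀ i, (m i).det = 0) ∨ ∃ a b, entGap (prodConj a b Z) < 0 := by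
  by_contra hcon
  rw [not_or] at hcon
  refine hcon.1 (exists_family_of_forall_add_smul_one fun n => ?_)
  have hn : (0 : ℝ) < 1 / (n + 1 : ℝ) := by positivity
  have hn' : (0 : ℂ) < ((1 / (n + 1 : ℝ) : ℝ) : ℂ) := by exact_mod_cast hn
  have hpd := Matrix.PosDef.posSemidef_add hZ (Matrix.PosDef.one.smul hn')
  refine (exists_family_or_filter_of_posDef hpd).resolve_right ?_
  rintro ⟨a, b, hab⟩
  refine hcon.2 ⟨a, b, ?_⟩
  -- a filter for the perturbed operator works for `Z`, as the perturbation is a product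
  have h1 : prodConj a b (1 : Matrix (Fin 2 × Fin 2) (Fin 2 × Fin 2) ℂ) = (a * aᴴ) ⊗ₖ (b * bᴴ) := by
    rw [← Matrix.one_kronecker_one, prodConj_kronecker, Matrix.mul_one, Matrix.mul_one]
  have h2 := entGap_kronecker_nonneg (Matrix.posSemidef_self_mul_conjTranspose a)
    (Matrix.posSemidef_self_mul_conjTranspose b)
  rw [← h1] at h2
  have h3 (r : ℝ) : entGap (prodConj a b (Z + (r : ℂ) • 1)) =
      entGap (prodConj a b Z) + r * entGap (prodConj a b 1) := by
    have h4 : prodConj a b (Z + (r : ℂ) • 1) = prodConj a b Z + (r : ℂ) • prodConj a b 1 := by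
      simp only [prodConj, Matrix.mul_add, Matrix.add_mul, Matrix.mul_smul, Matrix.smul_mul]
    have h5 := entGap_sum ![1, r] ![prodConj a b Z, prodConj a b 1]
    simp only [Fin.sum_univ_two, Matrix.cons_val_zero, Matrix.cons_val_one, Complex.ofReal_one,
      one_smul, one_mul] at h5
    rw [h4, h5]
  rw [h3] at hab
  nlinarith

/-! ### Separable operators -/

lemma exists_state_eq_smul {I : Type} [Fintype I] [Nonempty I] {S : Matrix I I ℂ}
    (hS : S.PosSemidef) : ∃ (s : ℝ) (σ : Matrix I I ℂ), 0 ≤ s ∧ IsState σ ∧ S = (s : ℂ) • σ := by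
  classical
  have h0 := Complex.nonneg_iff.mp hS.trace_nonneg
  have htr : S.trace = (S.trace.re : ℂ) := Complex.ext rfl (by simpa using h0.2.symm)
  by_cases h : S.trace = 0
  · let o : I := Classical.arbitrary I
    refine ⟨0, Matrix.vecMulVec (Pi.single o 1) (star (Pi.single o 1)), le_rfl,
      ⟨Matrix.posSemidef_vecMulVec_self_star _, ?_⟩, ?_⟩
    · simp [Matrix.trace, Matrix.vecMulVec_apply, Pi.single_apply]
    · rw [hS.trace_eq_zero_iff.mp h]
      simp
  · refine ⟨S.trace.re, S.trace⁻¹ • S, h0.1, ⟨hS.smul ?_, ?_⟩, ?_⟩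
    · rw [htr, ← Complex.ofReal_inv]
      exact_mod_cast inv_nonneg.mpr h0.1
    · rw [Matrix.trace_smul, smul_eq_mul, inv_mul_cancel₀ h]
    · rw [← htr, smul_smul, mul_inv_cancel₀ h, one_smul]

lemma isSeparable_of_eq_sum {A B : Type} [Fintype A] [Fintype B] {k : ℕ}
    {S : Fin k → Matrix A A ℂ} {T : Fin k → Matrix B B ℂ} (hS : ∀ i, (S i).PosSemidef)
    (hT : ∀ i, (T i).PosSemidef) {Y : Matrix (A × B) (A × B) ℂ} (hY : Y = ∑ i, S i ⊗ₖ T i)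
    (htr : Y.trace = 1) : IsSeparable Y := by
  have hne : Nonempty (A × B) := by
    by_contra hcon
    rw [not_nonempty_iff] at hcon
    simp [Matrix.trace] at htr
  have := hne.map Prod.fst
  have := hne.map Prod.snd
  choose s σ hs hσ hSσ using fun i => exists_state_eq_smul (hS i)
  choose t τ ht hτ hTτ using fun i => exists_state_eq_smul (hT i)
  have hY' : Y = ∑ i, ((s i * t i : ℝ) : ℂ) • (σ i ⊗ₖ τ i) := by
    rw [hY]
    refine Finset.sum_congr rfl fun i _ => ?_
    rw [hSσ, hTτ, Matrix.smul_kronecker, Matrix.kronecker_smul, smul_smul, Complex.ofReal_mul]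
  refine ⟨k, fun i => s i * t i, σ, τ, fun i => mul_nonneg (hs i) (ht i), ?_, hσ, hτ, hY'⟩
  rw [hY', Matrix.trace_sum] at htr
  simp only [Matrix.trace_smul, Matrix.trace_kronecker, (hσ _).2, (hτ _).2, mul_one,
    smul_eq_mul] at htr
  exact_mod_cast htr

lemma normalized_isState {I : Type} [Fintype I] {Y : Matrix I I ℂ} (hY : Y.PosSemidef)
    (h : Y.trace ≠ 0) : IsState (normalized Y) := by
  refine ⟨hY.smul ?_, ?_⟩
  · exact inv_nonneg.mpr hY.trace_nonneg
  · rw [normalized, Matrix.trace_smul, smul_eq_mul, inv_mul_cancel₀ h]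

/-- A `2 × 2` matrix without determinant is the matrix of a product vector. -/
lemma exists_vecMulVec_of_det_eq_zero {m : Matrix (Fin 2) (Fin 2) ℂ} (hm : m.det = 0) :
    ∃ e r : Fin 2 → ℂ, m = Matrix.vecMulVec e r := by
  rw [Matrix.det_fin_two] at hm
  by_cases h : m 0 0 = 0
  · rw [h, zero_mul, zero_sub, neg_eq_zero] at hm
    rcases mul_eq_zero.mp hm with h' | h'
    · refine ⟨![0, 1], m 1, ?_⟩
      ext i j
      fin_cases i <;> fin_cases j <;> simp [Matrix.vecMulVec_apply, h, h']
    · refine ⟨fun i => m i 1, ![0, 1], ?_⟩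
      ext i j
      fin_cases i <;> fin_cases j <;> simp [Matrix.vecMulVec_apply, h, h']
  · refine ⟨fun i => m i 0, fun j => m 0 j / m 0 0, ?_⟩
    ext i j
    fin_cases i <;> fin_cases j <;> simp [Matrix.vecMulVec_apply] <;> field_simp
    linear_combination hm

/-- Sums of product vectors are sums of products of positive semidefinite operators. -/
lemma exists_eq_sum_kronecker {m : Fin 4 → Matrix (Fin 2) (Fin 2) ℂ} (hm : ∀ i, (m i).det = 0) :
    ∃ S T : Fin 4 → Matrix (Fin 2) (Fin 2) ℂ, (∀ i, (S i).PosSemidef) ∧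
      (∀ i, (T i).PosSemidef) ∧ ofFamily m = ∑ i, S i ⊗ₖ T i := by
  choose e r her using fun i => exists_vecMulVec_of_det_eq_zero (hm i)
  refine ⟨fun i => Matrix.vecMulVec (e i) (star (e i)), fun i => Matrix.vecMulVec (r i) (star (r i)),
    fun i => Matrix.posSemidef_vecMulVec_self_star _,
    fun i => Matrix.posSemidef_vecMulVec_self_star _, ?_⟩
  ext x y
  simp only [ofFamily, Matrix.of_apply, Matrix.sum_apply, Matrix.kroneckerMap_apply, her,
    Matrix.vecMulVec_apply, Pi.star_apply, star_mul]
  refine Finset.sum_congr rfl fun i _ => ?_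
  ring

/-! ### From entangled projections to distillability -/

lemma exists_eq_mul_of_rank_eq {I J : Type} [Fintype I] [Fintype J] [DecidableEq J] {r : ℕ}
    {M : Matrix I J ℂ} (h : M.rank = r) :
    ∃ (L : Matrix I (Fin r) ℂ) (R : Matrix (Fin r) J ℂ), M = L * R := by
  let b : Module.Basis (Fin r) ℂ (LinearMap.range M.mulVecLin) := Module.finBasisOfFinrankEq ℂ _ h
  let c : J → LinearMap.range M.mulVecLin := fun j => ⟨M.mulVecLin (Pi.single j 1), _, rfl⟩
  refine ⟨Matrix.of fun i k => (b k : I → ℂ) i, Matrix.of fun k j => b.repr (c j) k, ?_⟩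
  ext i j
  have hc : (c j : I → ℂ) i = M i j := by simp [c]
  have h1 : (c j : I → ℂ) i =
      ((∑ k, b.repr (c j) k • b k : LinearMap.range M.mulVecLin) : I → ℂ) i := by
    rw [b.sum_repr]
  rw [← hc, h1]
  simp only [Submodule.coe_sum, Submodule.coe_smul, Finset.sum_apply, Pi.smul_apply, smul_eq_mul,
    Matrix.mul_apply, Matrix.of_apply, mul_comm]

lemma isDistillable_of_isEntangled {A B : Type} [Fintype A] [DecidableEq A] [Fintype B]
    [DecidableEq B] {ρ : Matrix (A × B) (A × B) ℂ} (hρ : ρ.PosSemidef) {n : ℕ}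
    {P : Matrix (Fin n → A) (Fin n → A) ℂ} {Q : Matrix (Fin n → B) (Fin n → B) ℂ}
    (hP : P.rank = 2) (hQ : Q.rank = 2)
    (h : IsEntangled (normalized (prodConj P Q (copies n ρ)))) : IsDistillable ρ := by
  obtain ⟨L, R, rfl⟩ := exists_eq_mul_of_rank_eq hP
  obtain ⟨L', R', rfl⟩ := exists_eq_mul_of_rank_eq hQ
  rw [← prodConj_prodConj] at h
  have hZ := prodConj_posSemidef R R' (copies_posSemidef n hρ)
  rcases exists_family_or_filter hZ with ⟨m, hm, hdet⟩ | ⟨a, b, hab⟩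
  · refine absurd ?_ h.2
    obtain ⟨S, T, hS, hT, hST⟩ := exists_eq_sum_kronecker hdet
    rw [hm, hST] at h ⊢
    set Y := prodConj L L' (∑ i, S i ⊗ₖ T i) with hY
    have hYps : Y.PosSemidef := prodConj_posSemidef _ _
      (Matrix.posSemidef_sum _ fun i _ => (hS i).kronecker (hT i))
    refine isSeparable_of_eq_sum (S := fun i => Y.trace⁻¹ • (L * S i * Lᴴ))
      (T := fun i => L' * T i * L'ᴴ) (fun i => ?_) (fun i => ?_) ?_ h.1.2
    · exact ((hS i).mul_mul_conjTranspose_same L).smul (inv_nonneg.mpr hYps.trace_nonneg)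
    · exact (hT i).mul_mul_conjTranspose_same L'
    · simp only [Matrix.smul_kronecker, ← Finset.smul_sum, ← prodConj_kronecker, ← prodConj_sum]
      rfl
  · refine isDistillable_of_fidelity (X := prodConj a b (prodConj R R' (copies n ρ)))
      ⟨n, (SepTo.single _ _ _).trans (SepTo.single _ _ _)⟩ (prodConj_posSemidef _ _ hZ) ?_
    rw [entGap, Complex.sub_re] at hab
    linarith

/-! ### From distillability to entangled projections -/

/-- The fidelity with the singlet becomes the fidelity with `(|00⟩ + |11⟩) / √2` after a rotation
of Bob's qubit. -/
lemma entGap_prodConj_rotation (Z : Matrix (Fin 2 × Fin 2) (Fin 2 × Fin 2) ℂ) :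
    entGap (prodConj 1 !![0, 1; -1, 0] Z) = (Z.trace - 2 * (Z * singlet).trace).re := by
  have hs : (((Real.sqrt 2 : ℝ) : ℂ)⁻¹) * ((Real.sqrt 2 : ℝ) : ℂ)⁻¹ = 1 / 2 := by
    rw [← mul_inv, ← Complex.ofReal_mul, Real.mul_self_sqrt (by norm_num)]
    norm_num
  rw [entGap]
  congr 1
  simp [prodConj, Matrix.trace, Matrix.mul_apply, Fintype.sum_prod_type, singlet, singletVec,
    Matrix.vecMulVec_apply, Matrix.one_apply]
  linear_combination (2 * (Z (0, 1) (0, 1) + Z (1, 0) (1, 0) - Z (0, 1) (1, 0) - Z (1, 0) (0, 1))) *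
    hs

/-- An LQCC operation with singlet fidelity above `1 / 2` has a single Kraus operator with this
property. -/
lemma IsDistillable.exists_entGap_neg {A B : Type} [Fintype A] [DecidableEq A] [Fintype B]
    [DecidableEq B] {ρ : Matrix (A × B) (A × B) ℂ} (hρ : ρ.PosSemidef) (h : IsDistillable ρ) :
    ∃ (n : ℕ) (a : Matrix (Fin 2) (Fin n → A) ℂ) (b : Matrix (Fin 2) (Fin n → B) ℂ),
      entGap (prodConj a b (copies n ρ)) < 0 := by
  obtain ⟨n, Λ, hΛ, htr, hfid⟩ := h 1 (1 / 2) (by norm_num)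
  obtain ⟨X, _, a, b, hab⟩ := hΛ.exists_kraus
  set R := copies n ρ with hR
  have hRps : R.PosSemidef := copies_posSemidef n hρ
  let f : Fin 2 → (Fin 1 → Fin 2) := fun i _ => i
  let e : Fin 2 × Fin 2 ≃ (Fin 1 → Fin 2) × (Fin 1 → Fin 2) :=
    (Equiv.funUnique (Fin 1) (Fin 2)).symm.prodCongr (Equiv.funUnique (Fin 1) (Fin 2)).symm
  have hsub (x : X) : prodConj ((a x).submatrix f id) ((b x).submatrix f id) R =
      (prodConj (a x) (b x) R).submatrix e e := rfl
  have htr' (Y : Matrix ((Fin 1 → Fin 2) × (Fin 1 → Fin 2)) ((Fin 1 → Fin 2) × (Fin 1 → Fin 2)) ℂ) :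
      (Y.submatrix e e).trace = Y.trace := Equiv.sum_comp e fun x => Y x x
  have hsing : (copies 1 singlet).submatrix e e = singlet := by
    ext x y
    simp [copies, e]
  by_contra! hcon
  have hY : Λ R = ∑ x, prodConj (a x) (b x) R := hab R
  have hnn : 0 ≤ entGap (prodConj 1 !![0, 1; -1, 0] ((Λ R).submatrix e e)) := by
    have h1 : (Λ R).submatrix e e =
        ∑ x, prodConj ((a x).submatrix f id) ((b x).submatrix f id) R := by
      rw [hY]
      ext i j
      simp only [hsub, Matrix.submatrix_apply, Matrix.sum_apply]
    rw [h1, prodConj_sum]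
    have h2 := entGap_sum (fun _ : X => 1) fun x => prodConj (1 : Matrix (Fin 2) (Fin 2) ℂ)
      !![0, 1; -1, 0] (prodConj ((a x).submatrix f id) ((b x).submatrix f id) R)
    simp only [Complex.ofReal_one, one_smul, one_mul] at h2
    rw [h2]
    refine Finset.sum_nonneg fun x _ => ?_
    rw [prodConj_prodConj]
    exact hcon n _ _
  have hYps : (Λ R).PosSemidef := by
    rw [hY]
    exact Matrix.posSemidef_sum _ fun x _ => prodConj_posSemidef _ _ hRps
  have h0 := Complex.nonneg_iff.mp hYps.trace_nonneg
  have htre : (Λ R).trace = ((Λ R).trace.re : ℂ) := Complex.ext rfl (by simpa using h0.2.symm)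
  have hpos : 0 < (Λ R).trace.re := h0.1.lt_of_ne' fun h =>
    htr (by rw [htre, h, Complex.ofReal_zero])
  have h3 : ((Λ R).submatrix e e * singlet).trace = (Λ R * copies 1 singlet).trace := by
    rw [← htr' (Λ R * copies 1 singlet), ← Matrix.submatrix_mul_equiv _ _ e e e, hsing]
  have h4 (x : ℂ) : (2 * x).re = 2 * x.re := by simp
  rw [entGap_prodConj_rotation, htr', h3, Complex.sub_re, h4] at hnn
  rw [singletFidelity, normalized, Matrix.smul_mul, Matrix.trace_smul, smul_eq_mul, htre,
    ← Complex.ofReal_inv, Complex.re_ofReal_mul, inv_mul_eq_div, lt_div_iff₀ hpos] at hfid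
  linarith

/-- The support projector of an operator of full row rank. -/
lemma exists_isTwoDimProjector {I : Type} [Fintype I] [DecidableEq I] {a : Matrix (Fin 2) I ℂ}
    (ha : IsUnit (a * aᴴ).det) : ∃ P : Matrix I I ℂ, IsTwoDimProjector P ∧ a * P = a := by
  set G := a * aᴴ with hG
  have hGG : G * G⁻¹ = 1 := Matrix.mul_nonsing_inv _ ha
  have haP : a * (aᴴ * G⁻¹ * a) = a := by
    rw [← Matrix.mul_assoc, ← Matrix.mul_assoc, ← hG, hGG, Matrix.one_mul]
  refine ⟨aᴴ * G⁻¹ * a, ⟨?_, ?_, le_antisymm ?_ ?_⟩, haP⟩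
  · have hGh : Gᴴ = G := by rw [hG, Matrix.conjTranspose_mul, Matrix.conjTranspose_conjTranspose]
    rw [Matrix.IsHermitian, Matrix.conjTranspose_mul, Matrix.conjTranspose_mul,
      Matrix.conjTranspose_conjTranspose, Matrix.conjTranspose_nonsing_inv, hGh, Matrix.mul_assoc]
  · rw [Matrix.mul_assoc (aᴴ * G⁻¹) a, haP]
  · exact (Matrix.rank_mul_le_right _ _).trans (by simpa using a.rank_le_card_height)
  · have h1 : G.rank = 2 := by
      rw [Matrix.rank_of_isUnit _ ((Matrix.isUnit_iff_isUnit_det _).mpr ha), Fintype.card_fin]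
    calc 2 = (a * (aᴴ * G⁻¹ * a) * aᴴ).rank := by rw [haP, ← hG, h1]
      _ ≤ (a * (aᴴ * G⁻¹ * a)).rank := Matrix.rank_mul_le_left _ _
      _ ≤ _ := Matrix.rank_mul_le_right _ _

lemma exists_eq_vecMulVec_of_not_isUnit {I : Type} [Fintype I] {a : Matrix (Fin 2) I ℂ}
    (ha : ¬ IsUnit (a * aᴴ).det) :
    ∃ (e : Fin 2 → ℂ) (r : I → ℂ), a = Matrix.vecMulVec e r := by
  rw [isUnit_iff_ne_zero, not_not] at ha
  obtain ⟨w, hw, hw0⟩ := Matrix.exists_vecMul_eq_zero_iff.mpr ha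
  have h1 : Matrix.vecMul w a = 0 := by
    have h2 : Matrix.vecMul w a ⬝ᵥ star (Matrix.vecMul w a) = 0 := by
      rw [Matrix.star_vecMul, Matrix.dotProduct_mulVec, Matrix.vecMul_vecMul, hw0, zero_dotProduct]
    exact dotProduct_self_star_eq_zero.mp h2
  have h3 (j : I) : w 0 * a 0 j + w 1 * a 1 j = 0 := by
    have := congrFun h1 j
    simpa [Matrix.vecMul, dotProduct, Fin.sum_univ_two] using this
  by_cases h : w 0 = 0
  · have hw1 : w 1 ≠ 0 := by
      intro h'
      apply hw
      ext i
      fin_cases i <;> simp [h, h']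
    refine ⟨![1, 0], a 0, ?_⟩
    ext i j
    have := h3 j
    rw [h, zero_mul, zero_add] at this
    fin_cases i <;> simp [Matrix.vecMulVec_apply, (mul_eq_zero.mp this).resolve_left hw1]
  · refine ⟨![-(w 1 / w 0), 1], a 1, ?_⟩
    ext i j
    fin_cases i <;> simp [Matrix.vecMulVec_apply]
    field_simp
    linear_combination h3 j

/-- A Kraus operator that has rank at most one on one side yields a product operator. -/
lemma isUnit_det_of_entGap_neg {I J : Type} [Fintype I] [Fintype J]
    {R : Matrix (I × J) (I × J) ℂ} (hR : R.PosSemidef) {a : Matrix (Fin 2) I ℂ}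
    {b : Matrix (Fin 2) J ℂ} (h : entGap (prodConj a b R) < 0) :
    IsUnit (a * aᴴ).det ∧ IsUnit (b * bᴴ).det := by
  have hcol (e : Fin 2 → ℂ) :
      Matrix.replicateCol Unit e * (1 : Matrix Unit Unit ℂ) * (Matrix.replicateCol Unit e)ᴴ =
      Matrix.vecMulVec e (star e) := by
    rw [Matrix.mul_one, Matrix.conjTranspose_replicateCol, Matrix.vecMulVec_eq Unit]
  constructor
  · by_contra ha
    obtain ⟨e, r, rfl⟩ := exists_eq_vecMulVec_of_not_isUnit ha
    have hT := (prodConj_posSemidef (Matrix.replicateRow Unit r) b hR).submatrix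
      fun i : Fin 2 => ((), i)
    have h1 : prodConj (Matrix.replicateRow Unit r) b R = (1 : Matrix Unit Unit ℂ) ⊗ₖ
        (prodConj (Matrix.replicateRow Unit r) b R).submatrix (fun i => ((), i))
          fun i => ((), i) := by
      ext x y
      simp [Matrix.kroneckerMap_apply]
    rw [Matrix.vecMulVec_eq Unit, ← Matrix.one_mul b, ← prodConj_prodConj, h1, prodConj_kronecker,
      hcol, Matrix.one_mul, Matrix.conjTranspose_one, Matrix.mul_one] at h
    exact absurd (entGap_kronecker_nonneg (Matrix.posSemidef_vecMulVec_self_star e) hT)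
      (not_le.mpr h)
  · by_contra hb
    obtain ⟨e, r, rfl⟩ := exists_eq_vecMulVec_of_not_isUnit hb
    have hT := (prodConj_posSemidef a (Matrix.replicateRow Unit r) hR).submatrix
      fun i : Fin 2 => (i, ())
    have h1 : prodConj a (Matrix.replicateRow Unit r) R =
        (prodConj a (Matrix.replicateRow Unit r) R).submatrix (fun i => (i, ()))
          (fun i => (i, ())) ⊗ₖ (1 : Matrix Unit Unit ℂ) := by
      ext x y
      simp [Matrix.kroneckerMap_apply]
    rw [Matrix.vecMulVec_eq Unit, ← Matrix.one_mul a, ← prodConj_prodConj, h1, prodConj_kronecker,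
      hcol, Matrix.one_mul, Matrix.conjTranspose_one, Matrix.mul_one] at h
    exact absurd (entGap_kronecker_nonneg hT (Matrix.posSemidef_vecMulVec_self_star e))
      (not_le.mpr h)

lemma IsDistillable.exists_isEntangled {A B : Type} [Fintype A] [DecidableEq A] [Fintype B]
    [DecidableEq B] {ρ : Matrix (A × B) (A × B) ℂ} (hρ : ρ.PosSemidef) (h : IsDistillable ρ) :
    ∃ (n : ℕ) (P : Matrix (Fin n → A) (Fin n → A) ℂ) (Q : Matrix (Fin n → B) (Fin n → B) ℂ),
      IsTwoDimProjector P ∧ IsTwoDimProjector Q ∧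
        IsEntangled (normalized (prodConj P Q (copies n ρ))) := by
  obtain ⟨n, a, b, hab⟩ := h.exists_entGap_neg hρ
  have hR := copies_posSemidef n hρ
  obtain ⟨ha, hb⟩ := isUnit_det_of_entGap_neg hR hab
  obtain ⟨P, hP, haP⟩ := exists_isTwoDimProjector ha
  obtain ⟨Q, hQ, hbQ⟩ := exists_isTwoDimProjector hb
  set Y := prodConj P Q (copies n ρ) with hY
  have hYab : prodConj a b Y = prodConj a b (copies n ρ) := by
    rw [hY, prodConj_prodConj, haP, hbQ]
  rw [← hYab] at hab
  have hYps : Y.PosSemidef := prodConj_posSemidef _ _ hR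
  have htr : Y.trace ≠ 0 := by
    intro h0
    rw [hYps.trace_eq_zero_iff.mp h0] at hab
    simp [prodConj, entGap] at hab
  refine ⟨n, P, Q, hP, hQ, normalized_isState hYps htr, ?_⟩
  rintro ⟨k, p, σ, τ, hp, -, hσ, hτ, hsum⟩
  have h0 := Complex.nonneg_iff.mp hYps.trace_nonneg
  have htre : Y.trace = (Y.trace.re : ℂ) := Complex.ext rfl (by simpa using h0.2.symm)
  have h1 : prodConj a b Y =
      ∑ i, ((Y.trace.re * p i : ℝ) : ℂ) • ((a * σ i * aᴴ) ⊗ₖ (b * τ i * bᴴ)) := by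
    have h2 : Y = ∑ i, ((Y.trace.re * p i : ℝ) : ℂ) • (σ i ⊗ₖ τ i) := by
      calc Y = Y.trace • normalized Y := by
            rw [normalized, smul_smul, mul_inv_cancel₀ htr, one_smul]
        _ = _ := by
            rw [hsum, htre, Finset.smul_sum]
            simp only [smul_smul, Complex.ofReal_mul, Complex.ofReal_re]
    conv_lhs => rw [h2]
    rw [prodConj_sum]
    refine Finset.sum_congr rfl fun i _ => ?_
    rw [← prodConj_kronecker]
    simp only [prodConj, Matrix.mul_smul, Matrix.smul_mul]
  rw [h1, entGap_sum] at hab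
  refine absurd (Finset.sum_nonneg fun i _ => ?_) (not_le.mpr hab)
  exact mul_nonneg (mul_nonneg h0.1 (hp i)) (entGap_kronecker_nonneg
    ((hσ i).1.mul_mul_conjTranspose_same a) ((hτ i).1.mul_mul_conjTranspose_same b))

end Distill

theorem mainTheorem4 {A B : Type} [Fintype A] [DecidableEq A] [Fintype B] [DecidableEq B]
    (ρ : Matrix (A × B) (A × B) ℂ) (hρ : Distill.IsState ρ) :
    Distill.IsDistillable ρ ↔
      ∃ (n : ℕ) (P : Matrix (Fin n → A) (Fin n → A) ℂ) (Q : Matrix (Fin n → B) (Fin n → B) ℂ),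
        Distill.IsTwoDimProjector P ∧ Distill.IsTwoDimProjector Q ∧
          Distill.IsEntangled
            (Distill.normalized ((P ⊗ₖ Q) * Distill.copies n ρ * (P ⊗ₖ Q))) := by
  have hpq {n : ℕ} {P : Matrix (Fin n → A) (Fin n → A) ℂ} {Q : Matrix (Fin n → B) (Fin n → B) ℂ}
      (hP : Distill.IsTwoDimProjector P) (hQ : Distill.IsTwoDimProjector Q) :
      (P ⊗ₖ Q) * Distill.copies n ρ * (P ⊗ₖ Q) = Distill.prodConj P Q (Distill.copies n ρ) := by
    rw [Distill.prodConj, Matrix.conjTranspose_kronecker, hP.1.eq, hQ.1.eq]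
  constructor
  · intro h
    obtain ⟨n, P, Q, hP, hQ, hPQ⟩ := h.exists_isEntangled hρ.1
    exact ⟨n, P, Q, hP, hQ, by rwa [hpq hP hQ]⟩
  · rintro ⟨n, P, Q, hP, hQ, hPQ⟩
    rw [hpq hP hQ] at hPQ
    exact Distill.isDistillable_of_isEntangled hρ.1 hP.2.2 hQ.2.2 hPQ
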